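/- Let $n \ge 3$, let $Y_n = \{1,\dots,n\} \times \mathbb{N}$, and let Houghton's group $\mathcal{H}_n$ be the group of all bijections $g : Y_n \to Y_n$ for which there are $(m_1,\dots,m_n) \in \mathbb{Z}^n$ and a finite set $K \subset Y_n$ such that $g$ maps $(k,p)$ to $(k,p+m_k)$ for all $(k,p) \in Y_n \setminus K$. For a finite presentation $P = \langle A \mid R\rangle$ of a group, the area of a word $w$ in the letters $A \cup A^{-1}$ that represents the identity is the least $N$ such that $w$ is freely equal to a product $\prod_{i=1}^N u_i^{-1} r_i u_i$ with $u_i \in F(A)$ and $r_i \in R^{\pm 1}$, and the Dehn function $\delta_P(x)$ is the maximum of the areas of all words of length at most $x$ that represent the identity. Then $\mathcal{H}_n$ is finitely presented and its Dehn function satisfies $$\delta_{\mathcal{H}_n}(x) \preccurlyeq e^x .$$ That is, for every finite presentation $P$ of $\mathcal{H}_n$ there is a constant $C > 0$ such that $\delta_P(x) \le C e^{Cx+C} + Cx + C$ for all $x \in \mathbb{N}$. -/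

import Mathlib

/-- A permutation `g` of `Y_n = {1, …, n} × ℕ` is an eventual translation if there are
`m ∈ ℤⁿ` and a finite set `K` such that `g (k, p) = (k, p + m k)` for all `(k, p) ∉ K`.
The points of each ray are numbered from `0` here, so `(k, p)` is the point of the `k`-th ray at
distance `p + 1` from the origin; the condition does not depend on this shift. -/
def IsEventualTranslation {n : ℕ} (g : Equiv.Perm (Fin n × ℕ)) : Prop :=
  ∃ (m : Fin n → ℤ) (K : Finset (Fin n × ℕ)), ∀ (k : Fin n) (p : ℕ), (k, p) ∉ K →
    (g (k, p)).1 = k ∧ ((g (k, p)).2 : ℤ) = p + m k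

/-- Houghton's group `H_n`: the group of all eventual translations of `Y_n`. The product is
composition of maps; composing in the other order gives the opposite group, which is isomorphic
to this one through `g ↦ g⁻¹`. -/
def houghtonGroup (n : ℕ) : Subgroup (Equiv.Perm (Fin n × ℕ)) where
  carrier := {g | IsEventualTranslation g}
  one_mem' := ⟨0, ∅, fun k p _ => by simp⟩
  mul_mem' := by
    rintro g h ⟨m, K, hg⟩ ⟨m', K', hh⟩
    refine ⟨m + m', K' ∪ K.image h.symm, fun k p hp => ?_⟩
    simp only [Finset.mem_union, Finset.mem_image, not_or, not_exists, not_and] at hp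
    obtain ⟨h1, h2⟩ := hh k p hp.1
    have h3 : h (k, p) ∉ K := fun hK => hp.2 _ hK (by simp)
    obtain ⟨h4, h5⟩ := hg (h (k, p)).1 (h (k, p)).2 h3
    refine ⟨h4.trans h1, ?_⟩
    simp only [Equiv.Perm.mul_apply, Pi.add_apply, Prod.mk.eta] at h5 ⊢
    rw [h5, h2, h1]
    ring
  inv_mem' := by
    rintro g ⟨m, K, hg⟩
    refine ⟨-m, K.image g, fun k p hp => ?_⟩
    have h3 : g⁻¹ (k, p) ∉ K := fun hK => hp (Finset.mem_image.2 ⟨_, hK, by simp⟩)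
    obtain ⟨h4, h5⟩ := hg (g⁻¹ (k, p)).1 (g⁻¹ (k, p)).2 h3
    have h6 : g (g⁻¹ (k, p)) = (k, p) := g.apply_symm_apply (k, p)
    simp only [Prod.mk.eta, h6] at h4 h5
    refine ⟨h4.symm, ?_⟩
    rw [← h4] at h5
    simp only [Pi.neg_apply]
    omega

/-- `⟨A | R⟩` is a presentation of `G`, where the generator `a` stands for `φ a ∈ G`: the induced
homomorphism from the free group on `A` to `G` is onto and its kernel is the normal closure
of `R`. -/
def IsPresentation {A G : Type*} [Group G] (φ : A → G) (R : Set (FreeGroup A)) : Prop :=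
  Function.Surjective (FreeGroup.lift φ) ∧ (FreeGroup.lift φ).ker = Subgroup.normalClosure R

/-- A word in the letters `A ∪ A⁻¹` (the letter `(a, true)` is `a` and `(a, false)` is `a⁻¹`) is
null-homotopic if it lies in the normal closure of the relators. -/
def IsNullHomotopic {A : Type*} (R : Set (FreeGroup A)) (w : List (A × Bool)) : Prop :=
  FreeGroup.mk w ∈ Subgroup.normalClosure R

/-- The word `w` is freely equal to a product of `N` factors `u⁻¹ r u` with `u` in the free group
and `r ∈ R ∪ R⁻¹`. -/
def HasFilling {A : Type*} (R : Set (FreeGroup A)) (w : List (A × Bool)) (N : ℕ) : Prop :=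
  ∃ L : List (FreeGroup A × FreeGroup A), L.length = N ∧
    (∀ c ∈ L, c.2 ∈ R ∨ c.2⁻¹ ∈ R) ∧
    FreeGroup.mk w = (L.map fun c => c.1⁻¹ * c.2 * c.1).prod

/-- The area of a null-homotopic word: the least number of factors in such a product. -/
noncomputable def wordArea {A : Type*} (R : Set (FreeGroup A)) (w : List (A × Bool)) : ℕ :=
  sInf {N | HasFilling R w N}

/-- The Dehn function of `⟨A | R⟩`: the largest area of a null-homotopic word of length at
most `x`. -/
noncomputable def dehnFunction {A : Type*} (R : Set (FreeGroup A)) (x : ℕ) : ℕ :=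
  sSup {N | ∃ w : List (A × Bool), IsNullHomotopic R w ∧ w.length ≤ x ∧ wordArea R w = N}

/-- `f ≼ g`: there is a constant `C > 0` with `f x ≤ C g (C x + C) + C x + C` for all `x`. -/
def GrowthLE (f g : ℕ → ℝ) : Prop :=
  ∃ C : ℕ, 0 < C ∧ ∀ x : ℕ, f x ≤ C * g (C * x + C) + C * x + C

/-- The null-homotopic words are exactly those that have a filling, so their area is attained. -/
theorem isNullHomotopic_iff_exists_hasFilling {A : Type*} (R : Set (FreeGroup A))
    (w : List (A × Bool)) : IsNullHomotopic R w ↔ ∃ N, HasFilling R w N := by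
  constructor
  · intro h
    suffices H : ∀ g ∈ Subgroup.normalClosure R, ∃ L : List (FreeGroup A × FreeGroup A),
        (∀ c ∈ L, c.2 ∈ R ∨ c.2⁻¹ ∈ R) ∧ g = (L.map fun c => c.1⁻¹ * c.2 * c.1).prod by
      obtain ⟨L, h1, h2⟩ := H _ h
      exact ⟨L.length, L, rfl, h1, h2⟩
    intro g hg
    induction hg using Subgroup.closure_induction with
    | mem x hx =>
      obtain ⟨r, hr, hrx⟩ := Group.mem_conjugatesOfSet_iff.1 hx
      obtain ⟨c, rfl⟩ := isConj_iff.1 hrx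
      exact ⟨[(c⁻¹, r)], by simp [hr], by simp⟩
    | one => exact ⟨[], by simp, by simp⟩
    | mul x y _ _ hx hy =>
      obtain ⟨L, h1, rfl⟩ := hx
      obtain ⟨L', h1', rfl⟩ := hy
      refine ⟨L ++ L', fun c hc => ?_, by simp⟩
      rcases List.mem_append.1 hc with hc | hc
      · exact h1 c hc
      · exact h1' c hc
    | inv x _ hx =>
      obtain ⟨L, h1, rfl⟩ := hx
      refine ⟨(L.map fun c => (c.1, c.2⁻¹)).reverse, fun c hc => ?_, ?_⟩
      · simp only [List.mem_reverse, List.mem_map] at hc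
        obtain ⟨d, hd, rfl⟩ := hc
        simpa using (h1 d hd).symm
      · rw [List.prod_inv_reverse]
        simp [Function.comp_def, mul_assoc]
  · rintro ⟨N, L, -, h1, h2⟩
    unfold IsNullHomotopic
    rw [h2]
    refine Subgroup.list_prod_mem _ fun x hx => ?_
    obtain ⟨c, hc, rfl⟩ := List.mem_map.1 hx
    have h3 : c.2 ∈ Subgroup.normalClosure R := by
      rcases h1 c hc with h | h
      · exact Subgroup.subset_normalClosure h
      · exact (Subgroup.inv_mem_iff _).1 (Subgroup.subset_normalClosure h)
    simpa using Subgroup.normalClosure_normal.conj_mem _ h3 c.1⁻¹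

/-- Over a finite alphabet the maximum in the definition of the Dehn function exists. -/
theorem isGreatest_dehnFunction {A : Type*} [Finite A] (R : Set (FreeGroup A)) (x : ℕ) :
    IsGreatest {N | ∃ w : List (A × Bool), IsNullHomotopic R w ∧ w.length ≤ x ∧ wordArea R w = N}
      (dehnFunction R x) := by
  have hfin : {N | ∃ w : List (A × Bool),
      IsNullHomotopic R w ∧ w.length ≤ x ∧ wordArea R w = N}.Finite :=
    ((List.finite_length_le (A × Bool) x).image (wordArea R)).subset
      fun N ⟨w, _, hw, hN⟩ => ⟨w, hw, hN⟩
  have hne : {N | ∃ w : List (A × Bool),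
      IsNullHomotopic R w ∧ w.length ≤ x ∧ wordArea R w = N}.Nonempty :=
    ⟨_, [], Subgroup.one_mem _, Nat.zero_le _, rfl⟩
  exact ⟨Nat.sSup_mem hne hfin.bddAbove, fun N hN => le_csSup hfin.bddAbove hN⟩

/-! The generators are the translations out of ray `0` and some transpositions near the origin; the
relators are all trivial words of length at most 1000. A word is brought to normal form by moving
translations past transpositions, and every relator used is counted. Distant transpositions are
spelled by explicit words: `adj i p` exchanges neighbours on a ray, `starWord` exchanges the base
point `(0, 0)` with another point, and `transp` exchanges any two points.

The exponential arises in one place, `adj_comm_aux`: a translation between two rays commutes with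
`adj i p` on a third. Up to a short relator such a translation is a detour through ray `i` and back,
corrected by one transposition of first points. The detour lowers `adj i (p + 1)` to level `p`,
where the inductive relations apply, and raises it again. A bounded number of level `p` relations is
used each time, so the cost at level `p` is at most `9 ^ p`.

Everything else is a polynomial multiple of this cost. Disjoint or adjacent transpositions on the
rays satisfy the Coxeter relations, obtained by translating relations at the origin outwards. It
follows that `adj` permutes the stars (`adj_conj_starAt`). Relations between two or three stars are
then obtained by sliding the points towards the origin, where they are short relators. Hence the
words `transp` conjugate one another as transpositions do (`transp_conj_transp`), and translations
move them as they move points (`transl_conj_transp`).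

A trivial word of length `x` thus becomes transpositions of points of height `O(x)` followed by a
word in translations. The latter has exponent sum zero in each letter, because displacement along a
ray is a homomorphism on eventual translations; cancelling its letters in pairs leaves only
transpositions. At most `x + x ^ 2` of them remain, and `TranspCost.fillsWithin` removes the points
one by one. The resulting bound shows both that the short relators present the group and that areas
are at most exponential; substituting generators carries it to every other finite presentation. -/

section Filling

/-! ### Calculus of filling areas -/

variable {F : Type*} [Group F] {R : Set F}

/-- `g` is a product of at most `k` conjugates of elements of `R ∪ R⁻¹`. -/
def FillsWithin (R : Set F) (k : ℕ) (g : F) : Prop :=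
  ∃ L : List (F × F), L.length ≤ k ∧ (∀ c ∈ L, c.2 ∈ R ∨ c.2⁻¹ ∈ R) ∧
    g = (L.map fun c => c.1⁻¹ * c.2 * c.1).prod

theorem FillsWithin.one : FillsWithin R 0 (1 : F) := ⟨[], by simp⟩

theorem FillsWithin.of_mem {g : F} (h : g ∈ R) : FillsWithin R 1 g :=
  ⟨[(1, g)], by simp [h]⟩

theorem FillsWithin.mono {k l : ℕ} {g : F} (h : FillsWithin R k g) (hkl : k ≤ l) :
    FillsWithin R l g := by
  obtain ⟨L, h1, h2⟩ := h
  exact ⟨L, h1.trans hkl, h2⟩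

theorem FillsWithin.mul {k l : ℕ} {g h : F} (hg : FillsWithin R k g) (hh : FillsWithin R l h) :
    FillsWithin R (k + l) (g * h) := by
  obtain ⟨L, h1, h2, rfl⟩ := hg
  obtain ⟨L', h1', h2', rfl⟩ := hh
  refine ⟨L ++ L', by simp; omega, fun c hc => ?_, by simp⟩
  rcases List.mem_append.1 hc with hc | hc
  · exact h2 c hc
  · exact h2' c hc

theorem FillsWithin.inv {k : ℕ} {g : F} (hg : FillsWithin R k g) : FillsWithin R k g⁻¹ := by
  obtain ⟨L, h1, h2, rfl⟩ := hg
  refine ⟨(L.map fun c => (c.1, c.2⁻¹)).reverse, by simpa, fun c hc => ?_, ?_⟩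
  · simp only [List.mem_reverse, List.mem_map] at hc
    obtain ⟨d, hd, rfl⟩ := hc
    simpa using (h2 d hd).symm
  · rw [List.prod_inv_reverse]
    simp [Function.comp_def, mul_assoc]

theorem FillsWithin.conj {k : ℕ} {g : F} (hg : FillsWithin R k g) (h : F) :
    FillsWithin R k (h * g * h⁻¹) := by
  obtain ⟨L, h1, h2, rfl⟩ := hg
  refine ⟨L.map fun c => (c.1 * h⁻¹, c.2), by simpa, fun c hc => ?_, ?_⟩
  · obtain ⟨d, hd, rfl⟩ := List.mem_map.1 hc
    exact h2 d hd
  · clear h1 h2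
    induction L with
    | nil => simp
    | cons a L ih =>
      simp only [List.map_cons, List.prod_cons] at ih ⊢
      rw [← ih]
      group

/-- A homomorphism that maps relators to elements of filling area at most `K` multiplies areas
by at most `K`. -/
theorem FillsWithin.map {F' : Type*} [Group F'] {R' : Set F'} (f : F →* F') {K : ℕ}
    (hf : ∀ r ∈ R, FillsWithin R' K (f r)) {k : ℕ} {g : F} (hg : FillsWithin R k g) :
    FillsWithin R' (K * k) (f g) := by
  obtain ⟨L, h1, h2, rfl⟩ := hg
  suffices H : FillsWithin R' (K * L.length) (f (L.map fun c => c.1⁻¹ * c.2 * c.1).prod) from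
    H.mono (Nat.mul_le_mul_left _ h1)
  clear h1
  induction L with
  | nil => simpa using FillsWithin.one
  | cons a L ih =>
    have h3 : FillsWithin R' K (f a.2) := by
      rcases h2 a (by simp) with h | h
      · exact hf _ h
      · simpa using (hf _ h).inv
    have h4 := (h3.conj (f a.1⁻¹)).mul (ih fun c hc => h2 c (by simp [hc]))
    simp only [List.map_cons, List.prod_cons, List.length_cons, map_mul, map_inv, inv_inv] at h4 ⊢
    exact h4.mono (by ring_nf; omega)

theorem FillsWithin.mem_normalClosure {k : ℕ} {g : F} (hg : FillsWithin R k g) :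
    g ∈ Subgroup.normalClosure R := by
  obtain ⟨L, -, h1, rfl⟩ := hg
  refine Subgroup.list_prod_mem _ fun x hx => ?_
  obtain ⟨c, hc, rfl⟩ := List.mem_map.1 hx
  have h3 : c.2 ∈ Subgroup.normalClosure R := by
    rcases h1 c hc with h | h
    · exact Subgroup.subset_normalClosure h
    · exact (Subgroup.inv_mem_iff _).1 (Subgroup.subset_normalClosure h)
  simpa using Subgroup.normalClosure_normal.conj_mem _ h3 c.1⁻¹

/-- `x` and `y` differ by an element of filling area at most `k`. -/
def Near (R : Set F) (k : ℕ) (x y : F) : Prop := FillsWithin R k (x * y⁻¹)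

theorem Near.refl (x : F) : Near R 0 x x := by simpa [Near] using FillsWithin.one

theorem Near.of_eq {x y : F} (h : x = y) : Near R 0 x y := h ▸ Near.refl x

theorem Near.mono {k l : ℕ} {x y : F} (h : Near R k x y) (hkl : k ≤ l) : Near R l x y :=
  FillsWithin.mono h hkl

theorem Near.symm {k : ℕ} {x y : F} (h : Near R k x y) : Near R k y x := by
  simpa [Near] using FillsWithin.inv h

theorem Near.trans {k l : ℕ} {x y z : F} (h : Near R k x y) (h' : Near R l y z) :
    Near R (k + l) x z := by
  simpa [Near, mul_assoc] using FillsWithin.mul h h'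

/-- The quotient is `x * (x' * y'⁻¹) * x⁻¹` times `x * y⁻¹`, and conjugation does not change filling
area. -/
theorem Near.mul {k l : ℕ} {x y x' y' : F} (h : Near R k x y) (h' : Near R l x' y') :
    Near R (k + l) (x * x') (y * y') := by
  have := FillsWithin.mul (FillsWithin.conj h' x) h
  rw [add_comm, Near]
  convert this using 1
  group

theorem Near.mul_left {k : ℕ} {x y : F} (g : F) (h : Near R k x y) : Near R k (g * x) (g * y) := by
  simpa using (Near.refl g).mul h

theorem Near.mul_right {k : ℕ} {x y : F} (h : Near R k x y) (g : F) : Near R k (x * g) (y * g) := by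
  simpa using h.mul (Near.refl g)

theorem Near.inv {k : ℕ} {x y : F} (h : Near R k x y) : Near R k x⁻¹ y⁻¹ := by
  have := FillsWithin.conj (FillsWithin.inv h) x⁻¹
  rw [Near]
  convert this using 1
  group

theorem Near.fillsWithin {k : ℕ} {x : F} (h : Near R k x 1) : FillsWithin R k x := by
  simpa [Near] using h

/-- Up to area `k`, conjugation by `g` maps `x` to `y`. -/
def Cj (R : Set F) (k : ℕ) (g x y : F) : Prop := Near R k (g * x) (y * g)

namespace Cj

variable {k l a b c : ℕ} {g h x y z x' y' g' : F}

theorem near (H : Cj R k g x y) : Near R k (g * x) (y * g) := H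

theorem mono (H : Cj R k g x y) (hkl : k ≤ l) : Cj R l g x y := Near.mono H hkl

theorem of_eq (H : g * x * g⁻¹ = y) : Cj R 0 g x y := Near.of_eq (by rw [← H]; group)

theorem comp (H : Cj R k g x y) (H' : Cj R l h y z) : Cj R (k + l) (h * g) x z := by
  have := (Near.mul_left h H.near).trans (by simpa [mul_assoc] using Near.mul_right H'.near g)
  simpa [Cj, mul_assoc] using this

theorem inv (H : Cj R k g x y) : Cj R k g⁻¹ y x := by
  have := (Near.mul_right (Near.mul_left g⁻¹ H.near) g⁻¹).symm
  simpa [Cj, mul_assoc] using this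

theorem mul (H : Cj R k g x y) (H' : Cj R l g x' y') : Cj R (k + l) g (x * x') (y * y') := by
  have := (Near.mul_right H.near x').trans (by simpa [mul_assoc] using Near.mul_left y H'.near)
  simpa [Cj, mul_assoc] using this

theorem inv_arg (H : Cj R k g x y) : Cj R k g x⁻¹ y⁻¹ := by
  have := (Near.mul_right (Near.mul_left y⁻¹ H.near) x⁻¹).symm
  simpa [Cj, mul_assoc] using this

theorem comm (H : Cj R k g x x) : Cj R k x g g := Near.symm H

theorem congr_conj (H : Cj R k g x y) (hg : Near R l g' g) : Cj R (k + 2 * l) g' x y :=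
  (((hg.mul_right x).trans H.near).trans (hg.symm.mul_left y)).mono (by omega)

theorem congr_target (H : Cj R k g x y) (hy : Near R l y y') : Cj R (k + l) g x y' :=
  H.near.trans (hy.mul_right g)

/-- Conjugating all three entries of a conjugation relation. -/
theorem transport (H : Cj R k g x y) (hg : Cj R a h g g') (hx : Cj R b h x x')
    (hy : Cj R c h y y') : Cj R (k + 2 * a + b + c) g' x' y' := by
  -- The conjugator stands on both sides of `g * x = y * g`, so its replacement is paid for twice.
  have h2 : Cj R (a + b) h (g * x) (g' * x') := hg.mul hx
  have h3 : Cj R (c + a) h (y * g) (y' * g') := hy.mul hg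
  have h4 : Near R (a + b) (g' * x') (h * (g * x) * h⁻¹) := by
    simpa [Cj, mul_assoc] using (Near.mul_right h2.near h⁻¹).symm
  have h5 : Near R (c + a) (h * (y * g) * h⁻¹) (y' * g') := by
    simpa [Cj, mul_assoc] using (Near.mul_right h3.near h⁻¹)
  exact ((h4.trans ((H.near.mul_left h).mul_right h⁻¹)).trans h5).mono (by omega)

end Cj

/-- Two elements commute up to area `k`. -/
abbrev NearComm (R : Set F) (k : ℕ) (g x : F) : Prop := Cj R k g x x

end Filling

/-! ### Translations along pairs of rays -/

section Translations

variable {n : ℕ}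

/-- One step along the line formed by the rays `i` and `j`, towards the end of the ray `j`. -/
def shiftFun (i j : Fin n) (y : Fin n × ℕ) : Fin n × ℕ :=
  if y.1 = i then (if y.2 = 0 then (j, 0) else (i, y.2 - 1))
  else if y.1 = j then (j, y.2 + 1) else y

theorem shiftFun_shiftFun {i j : Fin n} (h : i ≠ j) (y : Fin n × ℕ) :
    shiftFun j i (shiftFun i j y) = y := by
  obtain ⟨l, p⟩ := y
  by_cases h1 : l = i
  · subst h1
    cases p <;> simp [shiftFun, h]
  · by_cases h2 : l = j
    · subst h2
      simp [shiftFun, h.symm]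
    · simp [shiftFun, h1, h2]

/-- The translation along the line formed by the rays `i` and `j`. -/
def shift (i j : Fin n) : Equiv.Perm (Fin n × ℕ) :=
  if h : i = j then 1 else
    ⟨shiftFun i j, shiftFun j i, shiftFun_shiftFun h, shiftFun_shiftFun (Ne.symm h)⟩

theorem shift_self (i : Fin n) : shift i i = 1 := by simp [shift]

theorem shift_apply {i j : Fin n} (h : i ≠ j) (y : Fin n × ℕ) : shift i j y = shiftFun i j y := by
  simp [shift, h]

theorem shift_apply_zero (i j : Fin n) (h : i ≠ j) : shift i j (i, 0) = (j, 0) := by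
  simp [shift_apply h, shiftFun]

theorem shift_apply_succ (i j : Fin n) (h : i ≠ j) (p : ℕ) : shift i j (i, p + 1) = (i, p) := by
  simp [shift_apply h, shiftFun]

theorem shift_apply_target (i j : Fin n) (h : i ≠ j) (p : ℕ) :
    shift i j (j, p) = (j, p + 1) := by
  simp [shift_apply h, shiftFun, h.symm]

theorem shift_apply_of_ne (i j l : Fin n) (hi : l ≠ i) (hj : l ≠ j) (p : ℕ) :
    shift i j (l, p) = (l, p) := by
  by_cases h : i = j
  · simp [h, shift_self]
  · simp [shift_apply h, shiftFun, hi, hj]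

theorem shift_snd_le (i j : Fin n) (y : Fin n × ℕ) : (shift i j y).2 ≤ y.2 + 1 := by
  by_cases h : i = j
  · simp [h, shift_self]
  · rw [shift_apply h, shiftFun]
    split_ifs <;> simp
    omega

theorem shift_mul_shift (i j k : Fin n) : shift j i * shift k j = shift k i := by
  by_cases h1 : j = i
  · subst h1; simp [shift_self]
  by_cases h2 : k = j
  · subst h2; simp [shift_self]
  ext1 ⟨l, p⟩
  rw [Equiv.Perm.mul_apply, shift_apply h1, shift_apply h2]
  by_cases h3 : k = i
  · subst h3
    rw [shift_self, shiftFun_shiftFun (Ne.symm h1)]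
    simp
  · rw [shift_apply h3]
    simp only [shiftFun]
    by_cases h4 : l = k
    · subst h4
      cases p
      · simp
      · simp [h2, h3]
    · by_cases h5 : l = j
      · subst h5; simp [h4, h1]
      · simp [h4, h5]

theorem shift_inv (i j : Fin n) : (shift i j)⁻¹ = shift j i := by
  rw [inv_eq_iff_mul_eq_one, shift_mul_shift, shift_self]

/-- Composed in this order, the detour through ray `m` agrees with the direct shift except at two
first points. This discrepancy makes commutators of translations into transpositions. -/
theorem shift_mul_shift_of_ne {l m i : Fin n} (hlm : l ≠ m) (hl : l ≠ i) (hm : m ≠ i) :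
    shift l m * shift m i = shift l i * Equiv.swap (m, 0) (l, 0) := by
  ext1 ⟨j, p⟩
  rw [Equiv.Perm.mul_apply, Equiv.Perm.mul_apply]
  by_cases h1 : j = m
  · subst h1
    cases p with
    | zero =>
      rw [shift_apply_zero _ _ hm, shift_apply_of_ne _ _ _ hl.symm hm.symm, Equiv.swap_apply_left,
        shift_apply_zero _ _ hl]
    | succ p =>
      rw [shift_apply_succ _ _ hm, shift_apply_target _ _ hlm,
        Equiv.swap_apply_of_ne_of_ne (by simp) (by simp), shift_apply_of_ne _ _ _ hlm.symm hm]
  · by_cases h2 : j = l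
    · subst h2
      rw [shift_apply_of_ne _ _ _ hlm hl]
      cases p with
      | zero =>
        rw [shift_apply_zero _ _ hlm, Equiv.swap_apply_right, shift_apply_of_ne _ _ _ hlm.symm hm]
      | succ p =>
        rw [shift_apply_succ _ _ hlm, Equiv.swap_apply_of_ne_of_ne (by simp) (by simp),
          shift_apply_succ _ _ hl]
    · rw [Equiv.swap_apply_of_ne_of_ne (by simp [h1]) (by simp [h2])]
      by_cases h3 : j = i
      · subst h3
        rw [shift_apply_target _ _ hm, shift_apply_target _ _ hl, shift_apply_of_ne _ _ _ h2 h1]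
      · rw [shift_apply_of_ne _ _ _ h1 h3, shift_apply_of_ne _ _ _ h2 h1,
          shift_apply_of_ne _ _ _ h2 h3]

end Translations

/-! ### Generators, short relators and words for adjacent transpositions -/

section Generators

variable {m : ℕ}

/-- The generators: translations from the ray `0` to another ray and transpositions of points
near the origin. -/
abbrev HGen (m : ℕ) : Type := Fin (m + 2) ⊕ (Fin (m + 3) × Fin (m + 3))

/-- The permutation a generator stands for. -/
def genPerm : HGen m → Equiv.Perm (Fin (m + 3) × ℕ)
  | .inl j => shift 0 j.succ
  | .inr (i, j) => if i = j then Equiv.swap (i, 0) (i, 1) else Equiv.swap (i, 0) (j, 0)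

/-- The value of a word in the generators. -/
def wordPerm (m : ℕ) : FreeGroup (HGen m) →* Equiv.Perm (Fin (m + 3) × ℕ) :=
  FreeGroup.lift genPerm

/-- All relators up to a certain length. -/
def shortRelators (m : ℕ) : Set (FreeGroup (HGen m)) := {w | w.norm ≤ 1000 ∧ wordPerm m w = 1}

theorem shortRelators_finite : (shortRelators m).Finite := by
  refine ((List.finite_length_le (HGen m × Bool) 1000).image FreeGroup.mk).subset fun w hw => ?_
  exact ⟨w.toWord, hw.1, FreeGroup.mk_toWord⟩

/-- The generator shifting the ray `0` into the ray `j`. -/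
def transGen (j : Fin (m + 3)) : FreeGroup (HGen m) := Fin.cases 1 (fun j => .of (.inl j)) j

/-- The word for the translation from the ray `i` to the ray `j`. -/
def transl (i j : Fin (m + 3)) : FreeGroup (HGen m) := transGen j * (transGen i)⁻¹

/-- The word for the transposition of the first points of two rays. -/
def corner (i j : Fin (m + 3)) : FreeGroup (HGen m) := .of (.inr (i, j))

/-- The word for the transposition of `(i, p)` and `(i, p + 1)`. -/
def adj (i : Fin (m + 3)) : ℕ → FreeGroup (HGen m)
  | 0 => corner i i
  -- The ray `i + 1` is an arbitrary choice of a ray other than `i`; replacing it by another one is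
  -- exactly what costs area.
  | p + 1 => transl (i + 1) i * adj i p * (transl (i + 1) i)⁻¹

theorem transl_mul_transl (i j k : Fin (m + 3)) : transl (m := m) j i * transl k j = transl k i := by
  simp [transl]

theorem transl_inv (i j : Fin (m + 3)) : (transl (m := m) i j)⁻¹ = transl j i := by
  simp [transl]

theorem wordPerm_transGen (j : Fin (m + 3)) : wordPerm m (transGen j) = shift 0 j := by
  cases j using Fin.cases with
  | zero => simp [transGen, shift_self]
  | succ j => simp [transGen, wordPerm, genPerm]

theorem wordPerm_transl (i j : Fin (m + 3)) : wordPerm m (transl i j) = shift i j := by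
  rw [transl, map_mul, map_inv, wordPerm_transGen, wordPerm_transGen, shift_inv, shift_mul_shift]

theorem wordPerm_corner {i j : Fin (m + 3)} (h : i ≠ j) :
    wordPerm m (corner i j) = Equiv.swap (i, 0) (j, 0) := by
  simp [corner, wordPerm, genPerm, h]

theorem wordPerm_adj_zero (i : Fin (m + 3)) :
    wordPerm m (adj i 0) = Equiv.swap (i, 0) (i, 1) := by
  simp [adj, corner, wordPerm, genPerm]

theorem add_one_ne_self (i : Fin (m + 3)) : i + 1 ≠ i := by
  simp

theorem mul_swap_mul_inv {α : Type*} [DecidableEq α] (f : Equiv.Perm α) (x y : α) :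
    f * Equiv.swap x y * f⁻¹ = Equiv.swap (f x) (f y) :=
  (Equiv.swap_apply_apply f x y).symm

theorem wordPerm_adj (i : Fin (m + 3)) (p : ℕ) :
    wordPerm m (adj i p) = Equiv.swap (i, p) (i, p + 1) := by
  induction p with
  | zero => exact wordPerm_adj_zero i
  | succ p ih =>
    rw [adj, map_mul, map_mul, map_inv, ih, wordPerm_transl, mul_swap_mul_inv,
      shift_apply_target _ _ (add_one_ne_self i), shift_apply_target _ _ (add_one_ne_self i)]

/-- `x` has length at most `k`. -/
def Short (k : ℕ) (x : FreeGroup (HGen m)) : Prop := x.norm ≤ k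

theorem Short.mul {k l : ℕ} {x y : FreeGroup (HGen m)} (hx : Short k x) (hy : Short l y) :
    Short (k + l) (x * y) :=
  (FreeGroup.norm_mul_le x y).trans (Nat.add_le_add hx hy)

theorem Short.inv {k : ℕ} {x : FreeGroup (HGen m)} (hx : Short k x) : Short k x⁻¹ := by
  rwa [Short, FreeGroup.norm_inv_eq]

theorem Short.mono {k l : ℕ} {x : FreeGroup (HGen m)} (hx : Short k x) (h : k ≤ l) : Short l x :=
  le_trans hx h

theorem short_transGen (j : Fin (m + 3)) : Short 1 (transGen (m := m) j) := by
  cases j using Fin.cases with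
  | zero => simp [transGen, Short]
  | succ j => simp [transGen, Short]

theorem short_transl (i j : Fin (m + 3)) : Short 2 (transl (m := m) i j) :=
  (short_transGen j).mul (short_transGen i).inv

theorem short_corner (i j : Fin (m + 3)) : Short 1 (corner (m := m) i j) := by
  simp [Short, corner]

theorem short_adj (i : Fin (m + 3)) (p : ℕ) : Short (4 * p + 1) (adj (m := m) i p) := by
  induction p with
  | zero => exact short_corner i i
  | succ p ih =>
    exact (((short_transl _ _).mul ih).mul (short_transl _ _).inv).mono (by omega)

/-- Any identity between boundedly many letters is itself a relator. The bound 1000 is generous: the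
identities used have fewer than 300 letters. -/
theorem near_of_short {k l : ℕ} {x y : FreeGroup (HGen m)} (hx : Short k x) (hy : Short l y)
    (hkl : k + l ≤ 1000) (h : wordPerm m x = wordPerm m y) : Near (shortRelators m) 1 x y :=
  FillsWithin.of_mem ⟨(hx.mul hy.inv).trans hkl, by rw [map_mul, map_inv, h, mul_inv_cancel]⟩

theorem cj_of_short {k l l' : ℕ} {g x y : FreeGroup (HGen m)} (hg : Short k g) (hx : Short l x)
    (hy : Short l' y) (hkl : 2 * k + l + l' ≤ 1000) (u v : Fin (m + 3) × ℕ)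
    (hu : wordPerm m x = Equiv.swap u v)
    (hv : wordPerm m y = Equiv.swap (wordPerm m g u) (wordPerm m g v)) :
    Cj (shortRelators m) 1 g x y := by
  refine near_of_short (hg.mul hx) (hy.mul hg) (by omega) ?_
  rw [map_mul, map_mul, hu, hv, ← mul_swap_mul_inv]
  group

/-- A third ray gives room to move the points of one ray without touching those of another. -/
theorem exists_ne_ne (i j : Fin (m + 3)) : ∃ k, k ≠ i ∧ k ≠ j := by
  have : ({i, j} : Finset (Fin (m + 3))).card < Fintype.card (Fin (m + 3)) :=
    lt_of_le_of_lt Finset.card_le_two (by simp)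
  obtain ⟨k, hk⟩ := Finset.exists_mem_notMem_of_card_lt_card (s := {i, j}) (t := Finset.univ)
    (by simpa using this)
  exact ⟨k, by simpa using hk.2⟩

end Generators

/-! ### Coxeter relations between adjacent transpositions -/

section AdjacentTranspositions

variable {m : ℕ}

local notation "S" => shortRelators m

theorem adj_zero_comm {i l k : Fin (m + 3)} (hl : l ≠ i) (hk : k ≠ i) :
    NearComm S 1 (transl l k) (adj i 0) :=
  cj_of_short (short_transl _ _) (short_adj _ _) (short_adj _ _) (by omega) (i, 0) (i, 1)
    (wordPerm_adj_zero i) (by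
      rw [wordPerm_transl, wordPerm_adj_zero, shift_apply_of_ne _ _ _ hl.symm hk.symm,
        shift_apply_of_ne _ _ _ hl.symm hk.symm])

theorem adj_zero_comm_adj_zero {i l : Fin (m + 3)} (hl : l ≠ i) :
    NearComm S 1 (adj l 0) (adj i 0) :=
  cj_of_short (short_adj _ _) (short_adj _ _) (short_adj _ _) (by omega) (i, 0) (i, 1)
    (wordPerm_adj_zero i) (by
      rw [wordPerm_adj_zero, wordPerm_adj_zero,
        Equiv.swap_apply_of_ne_of_ne (by simp [hl.symm]) (by simp [hl.symm]),
        Equiv.swap_apply_of_ne_of_ne (by simp [hl.symm]) (by simp [hl.symm])])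

theorem transl_conj_adj_zero {l k : Fin (m + 3)} (h : l ≠ k) :
    Cj S 1 (transl l k) (adj l 0) (corner k l) :=
  cj_of_short (short_transl _ _) (short_adj _ _) (short_corner _ _) (by omega) (l, 0) (l, 1)
    (wordPerm_adj_zero l) (by
      rw [wordPerm_corner h.symm, wordPerm_transl, shift_apply_zero _ _ h,
        shift_apply_succ _ _ h])

theorem transl_mul_transl_near {l k i : Fin (m + 3)} (hlk : l ≠ k) (hl : l ≠ i) (hk : k ≠ i) :
    Near S 1 (transl l k * transl k i) (transl l i * corner k l) :=
  near_of_short ((short_transl _ _).mul (short_transl _ _))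
    ((short_transl _ _).mul (short_corner _ _)) (by omega) (by
      rw [map_mul, map_mul, wordPerm_transl, wordPerm_transl, wordPerm_transl,
        wordPerm_corner hlk.symm, shift_mul_shift_of_ne hlk hl hk])

theorem transl_comm_adj_zero_of_ne {k i l : Fin (m + 3)} (hlk : l ≠ k) (hl : l ≠ i) :
    NearComm S 1 (transl k i) (adj l 0) :=
  adj_zero_comm hlk.symm hl.symm

/-- The translations and the transpositions that avoid the ray `i` commute with the adjacent
transpositions of this ray, at exponential cost. -/
theorem adj_comm_aux (p : ℕ) (i : Fin (m + 3)) :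
    (∀ l k, l ≠ i → k ≠ i → NearComm S (9 ^ p) (transl l k) (adj i p)) ∧
    (∀ l, l ≠ i → NearComm S (9 ^ p) (adj l 0) (adj i p)) := by
  induction p with
  | zero => exact ⟨fun l k hl hk => adj_zero_comm hl hk, fun l hl => adj_zero_comm_adj_zero hl⟩
  | succ p ih =>
    obtain ⟨hA, hB⟩ := ih
    have h1 : 1 ≤ 9 ^ p := Nat.one_le_pow _ _ (by norm_num)
    -- Every ray `l` may replace `i + 1` in the recursion for `adj`: the two translations differ by
    -- one between rays other than `i`, which commutes with `adj i p`.
    have hD : ∀ l, l ≠ i → Cj S (9 ^ p) (transl l i) (adj i p) (adj i (p + 1)) := by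
      intro l hl
      have h2 : Cj S 0 (transl (i + 1) i) (adj i p) (adj i (p + 1)) := Cj.of_eq rfl
      have h3 := (hA l (i + 1) hl (add_one_ne_self i)).comp h2
      rwa [transl_mul_transl, add_zero] at h3
    -- `corner k l` is `adj l 0` conjugated by `transl l k`, and both commute with `adj i p`.
    have hC : ∀ l k, l ≠ k → l ≠ i → k ≠ i →
        NearComm S (3 * 9 ^ p + 2) (corner k l) (adj i p) := by
      intro l k hlk hl hk
      exact ((hB l hl).transport (transl_conj_adj_zero hlk) (hA l k hl hk) (hA l k hl hk)).mono
        (by omega)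
    constructor
    · intro l k hl hk
      by_cases hlk : l = k
      · subst hlk
        refine (Cj.of_eq ?_ : Cj S 0 _ _ _).mono (by omega)
        simp [transl]
      -- Up to a relator, `transl l k` is `transl l i * corner k l * (transl k i)⁻¹`: it lowers `adj
      -- i (p + 1)` to `adj i p`, fixes that, and raises it again. The total is `5 * 9 ^ p + 4`, at
      -- most `9 ^ (p + 1)`; hence the base 9.
      have h4 := (((hC l k hlk hl hk).comp (hD l hl)).congr_conj
        (transl_mul_transl_near hlk hl hk))
      have h5 := (hD k hk).inv.comp h4
      rw [mul_inv_cancel_right] at h5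
      refine h5.mono ?_
      rw [pow_succ]
      omega
    · intro l hl
      obtain ⟨k, hki, hkl⟩ := exists_ne_ne i l
      -- Translating from a third ray `k` into `i` raises `adj i p` by one level and leaves `adj l
      -- 0` alone.
      refine ((hB l hl).transport (transl_comm_adj_zero_of_ne hkl.symm hl) (hD k hki)
        (hD k hki)).mono ?_
      rw [pow_succ]
      omega

variable {N U : ℕ}

/-- All the exponential costs up to level `N` are at most `U`. -/
structure LevelCost (N U : ℕ) : Prop where
  le : 5 * 9 ^ N ≤ U

theorem LevelCost.pow_le (H : LevelCost N U) {p : ℕ} (hp : p ≤ N) : 5 * 9 ^ p ≤ U :=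
  (Nat.mul_le_mul_left 5 (Nat.pow_le_pow_right (by norm_num) hp)).trans H.le

theorem LevelCost.pos (H : LevelCost N U) : 5 ≤ U := by
  have := H.pow_le (Nat.zero_le N)
  omega

theorem adj_comm_transl (H : LevelCost N U) {p : ℕ} (hp : p ≤ N) {i l k : Fin (m + 3)}
    (hl : l ≠ i) (hk : k ≠ i) : NearComm S U (transl l k) (adj i p) :=
  ((adj_comm_aux p i).1 l k hl hk).mono (by have := H.pow_le hp; omega)

theorem adj_comm_adj_zero (H : LevelCost N U) {p : ℕ} (hp : p ≤ N) {i l : Fin (m + 3)}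
    (hl : l ≠ i) : NearComm S U (adj l 0) (adj i p) :=
  ((adj_comm_aux p i).2 l hl).mono (by have := H.pow_le hp; omega)

theorem transl_conj_adj (H : LevelCost N U) {p : ℕ} (hp : p ≤ N) {i l : Fin (m + 3)}
    (hl : l ≠ i) : Cj S U (transl l i) (adj i p) (adj i (p + 1)) := by
  have h2 : Cj S 0 (transl (i + 1) i) (adj i p) (adj i (p + 1)) := Cj.of_eq rfl
  have h3 := (adj_comm_transl H hp hl (add_one_ne_self i)).comp h2
  rwa [transl_mul_transl, add_zero] at h3

theorem transl_conj_adj_succ (H : LevelCost N U) {p : ℕ} (hp : p ≤ N) {i l : Fin (m + 3)}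
    (hl : l ≠ i) : Cj S U (transl i l) (adj i (p + 1)) (adj i p) := by
  rw [← transl_inv]
  exact (transl_conj_adj H hp hl).inv

theorem adj_comm_corner (H : LevelCost N U) {p : ℕ} (hp : p ≤ N) {i l k : Fin (m + 3)}
    (hlk : l ≠ k) (hl : l ≠ i) (hk : k ≠ i) : NearComm S U (corner l k) (adj i p) :=
  (((adj_comm_aux p i).2 k hk).transport (transl_conj_adj_zero hlk.symm)
    ((adj_comm_aux p i).1 k l hk hl) ((adj_comm_aux p i).1 k l hk hl)).mono
    (by have := H.pow_le hp; have : 1 ≤ 9 ^ p := Nat.one_le_pow _ _ (by norm_num); omega)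

/-- A short word for the transposition of the first points of the rays `i` and `j` commutes with
the adjacent transpositions of the ray `i` that it does not touch. -/
theorem adj_succ_comm_of_corner (H : LevelCost N U) {p : ℕ} (hp : p ≤ N) {i j : Fin (m + 3)}
    (hij : i ≠ j) {g : FreeGroup (HGen m)} (hg : Short 1 g)
    (hgv : wordPerm m g = Equiv.swap (i, 0) (j, 0)) :
    NearComm S (4 * U) g (adj i (p + 1)) := by
  obtain ⟨k, hki, hkj⟩ := exists_ne_ne i j
  have h1 : Cj S 1 (transl k i) (corner k j) g :=
    cj_of_short (short_transl _ _) (short_corner _ _) hg (by omega) (k, 0) (j, 0)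
      (wordPerm_corner hkj) (by
        rw [hgv, wordPerm_transl, shift_apply_zero _ _ hki,
          shift_apply_of_ne _ _ _ hkj.symm hij.symm])
  refine ((adj_comm_corner H hp hkj hki hij.symm).transport h1
    (transl_conj_adj H hp hki) (transl_conj_adj H hp hki)).mono ?_
  have := H.pos
  omega

/-- A translation from a third ray into `i` raises the first transposition and fixes the second.
Each level adds a fixed number of relations of cost `U`, so no second exponential appears. -/
theorem adj_comm_adj_of_ne (H : LevelCost N U) {p q : ℕ} (hp : p ≤ N) (hq : q ≤ N)
    {i j : Fin (m + 3)} (hij : i ≠ j) : NearComm S ((4 * p + 1) * U) (adj i p) (adj j q) := by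
  induction p with
  | zero => simpa using adj_comm_adj_zero H hq hij
  | succ p ih =>
    obtain ⟨k, hki, hkj⟩ := exists_ne_ne i j
    refine ((ih (by omega)).transport (transl_conj_adj H (by omega) hki)
      (adj_comm_transl H hq hkj hij) (adj_comm_transl H hq hkj hij)).mono ?_
    apply le_of_eq
    ring

/-- Two steps along the line from ray `i + 1` to ray `i` carry the commuting pair `adj (i + 1) 0`,
`adj i q` to `adj i 0`, `adj i (q + 2)`; further steps raise both. -/
theorem adj_comm_adj_same (H : LevelCost N U) {p q : ℕ} (hp : p + q + 2 ≤ N)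
    (i : Fin (m + 3)) : NearComm S ((4 * p + 7) * U) (adj i p) (adj i (p + q + 2)) := by
  have hi := add_one_ne_self i
  induction p with
  | zero =>
    have h2 : Cj S 1 (transl (i + 1) i * transl (i + 1) i) (adj (i + 1) 0) (adj i 0) := by
      refine cj_of_short ((short_transl _ _).mul (short_transl _ _)) (short_adj _ _)
        (short_adj _ _) (by omega) (i + 1, 0) (i + 1, 1) (wordPerm_adj_zero _) ?_
      rw [map_mul, wordPerm_transl, wordPerm_adj_zero, Equiv.Perm.mul_apply, Equiv.Perm.mul_apply,
        shift_apply_zero _ _ hi, shift_apply_target _ _ hi, shift_apply_succ _ _ hi,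
        shift_apply_zero _ _ hi, Equiv.swap_comm]
    have h3 := (transl_conj_adj H (p := q) (by omega) hi).comp
      (transl_conj_adj H (p := q + 1) (by omega) hi)
    have h4 := (adj_comm_adj_zero H (p := q) (by omega) hi).transport h2 h3 h3
    rw [show 0 + q + 2 = q + 1 + 1 by omega]
    refine h4.mono ?_
    have := H.pos
    omega
  | succ p ih =>
    have h4 := (ih (by omega)).transport (transl_conj_adj H (p := p) (by omega) hi)
      (transl_conj_adj H (p := p + q + 2) (by omega) hi)
      (transl_conj_adj H (p := p + q + 2) (by omega) hi)
    rw [show p + 1 + q + 2 = p + q + 2 + 1 by omega]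
    refine h4.mono ?_
    apply le_of_eq
    ring

theorem adj_braid (H : LevelCost N U) {p : ℕ} (hp : p + 1 ≤ N) (i : Fin (m + 3)) :
    Cj S ((6 * p + 1) * U) (adj i p * adj i (p + 1)) (adj i p) (adj i (p + 1)) := by
  have hi := add_one_ne_self i
  induction p with
  | zero =>
    refine (cj_of_short ((short_adj i 0).mul (short_adj i 1)) (short_adj _ _) (short_adj _ _)
      (by omega) (i, 0) (i, 1) (wordPerm_adj_zero i) ?_).mono (by have := H.pos; omega)
    have e1 : Equiv.swap (i, 1) (i, 2) (i, 0) = (i, 0) :=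
      Equiv.swap_apply_of_ne_of_ne (by simp) (by simp)
    have e2 : Equiv.swap (i, 0) (i, 1) (i, 2) = (i, 2) :=
      Equiv.swap_apply_of_ne_of_ne (by simp) (by simp)
    simp [wordPerm_adj, e1, e2]
  | succ p ih =>
    have h1 := transl_conj_adj H (p := p) (by omega) hi
    have h2 := transl_conj_adj H (p := p + 1) (by omega) hi
    refine ((ih (by omega)).transport (h1.mul h2) h1 h2).mono ?_
    apply le_of_eq
    ring

theorem adj_mul_self (i : Fin (m + 3)) (p : ℕ) : FillsWithin S 1 (adj i p * adj i p) := by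
  induction p with
  | zero =>
    refine (near_of_short (y := 1) ((short_adj i 0).mul (short_adj i 0)) (l := 0) ?_ (by omega)
      ?_).fillsWithin
    · simp [Short]
    · simp [wordPerm_adj_zero]
  | succ p ih =>
    convert ih.conj (transl (i + 1) i) using 1
    rw [adj]
    group

theorem adj_near_inv (i : Fin (m + 3)) (p : ℕ) : Near S 1 (adj i p) (adj i p)⁻¹ := by
  simpa [Near] using adj_mul_self i p

end AdjacentTranspositions

/-! ### Transpositions with the base point -/

section StarTranspositions

variable {m : ℕ}

local notation "S" => shortRelators m

variable {N U : ℕ}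

theorem adj_comm_adj (H : LevelCost N U) {p q : ℕ} (hp : p ≤ N) (hq : q ≤ N)
    {i j : Fin (m + 3)} (h : i ≠ j ∨ p + 2 ≤ q ∨ q + 2 ≤ p) :
    NearComm S ((6 * N + 7) * U) (adj i p) (adj j q) := by
  by_cases hij : i = j
  · subst hij
    rcases h with h | h | h
    · exact absurd rfl h
    · obtain ⟨r, rfl⟩ := Nat.exists_eq_add_of_le h
      rw [show p + 2 + r = p + r + 2 by omega] at hq ⊢
      exact (adj_comm_adj_same H hq i).mono (Nat.mul_le_mul_right _ (by omega))
    · obtain ⟨r, rfl⟩ := Nat.exists_eq_add_of_le h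
      rw [show q + 2 + r = q + r + 2 by omega] at hp ⊢
      exact (adj_comm_adj_same H hp i).comm.mono (Nat.mul_le_mul_right _ (by omega))
  · exact (adj_comm_adj_of_ne H hp hq hij).mono (Nat.mul_le_mul_right _ (by omega))

/-- The word for the transposition of `(0, 0)` and `(i, p)`. -/
def starWord (i : Fin (m + 3)) : ℕ → FreeGroup (HGen m)
  | 0 => corner 0 i
  -- At the base point itself the word is meaningless, so on ray `0` the recursion starts afresh at
  -- height 1.
  | p + 1 => if i = 0 ∧ p = 0 then adj 0 0 else adj i p * starWord i p * (adj i p)⁻¹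

theorem star_succ {i : Fin (m + 3)} {p : ℕ} (h : (i, p) ≠ (0, 0)) :
    starWord (m := m) i (p + 1) = adj i p * starWord i p * (adj i p)⁻¹ := by
  rw [starWord, if_neg]
  simpa using h

theorem star_zero_one : starWord (m := m) 0 1 = adj 0 0 := by simp [starWord]

theorem wordPerm_star {i : Fin (m + 3)} {p : ℕ} (h : (i, p) ≠ (0, 0)) :
    wordPerm m (starWord i p) = Equiv.swap (0, 0) (i, p) := by
  induction p with
  | zero => exact wordPerm_corner fun h' => h (by rw [h'])
  | succ p ih =>
    by_cases h' : (i, p) = (0, 0)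
    · obtain ⟨rfl, rfl⟩ := Prod.mk.inj h'
      rw [star_zero_one, wordPerm_adj]
    · rw [star_succ h', map_mul, map_mul, map_inv, ih h', wordPerm_adj, mul_swap_mul_inv,
        Equiv.swap_apply_left, Equiv.swap_apply_of_ne_of_ne (Ne.symm h')]
      simp

theorem short_star (i : Fin (m + 3)) (p : ℕ) : Short (4 * p * p + 1) (starWord (m := m) i p) := by
  induction p with
  | zero => exact short_corner 0 i
  | succ p ih =>
    rw [starWord]
    split_ifs with h
    · exact (short_adj 0 0).mono (by omega)
    · exact (((short_adj i p).mul ih).mul (short_adj i p).inv).mono (by ring_nf; omega)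

/-- The star at height `q` is the star at height `q₀` conjugated by the `adj j r` in between. The
starting height varies because it is 1 on ray `0` and 0 on the other rays. -/
theorem NearComm.star_of_le {g : FreeGroup (HGen m)} {k l q₀ : ℕ} {j : Fin (m + 3)}
    (h0 : (j, q₀) ≠ (0, 0)) (hk : NearComm S k g (starWord j q₀)) {q : ℕ} (hq : q₀ ≤ q)
    (hl : ∀ r, q₀ ≤ r → r < q → NearComm S l g (adj j r)) :
    NearComm S (k + 2 * (q - q₀) * l) g (starWord j q) := by
  induction q, hq using Nat.le_induction with
  | base => exact hk.mono (by omega)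
  | succ q hq ih =>
    have h1 : (j, q) ≠ (0, 0) := by
      intro h
      obtain ⟨rfl, rfl⟩ := Prod.mk.inj h
      exact h0 (by rw [Nat.le_zero.1 hq])
    have h2 := hl q hq (by omega)
    rw [star_succ h1]
    refine ((h2.mul (ih fun r hr hr' => hl r hr (by omega))).mul h2.inv_arg).mono ?_
    rw [show q + 1 - q₀ = q - q₀ + 1 by omega]
    apply le_of_eq
    ring

theorem adj_comm_star_of_ne (H : LevelCost N U) {p q : ℕ} (hp : p ≤ N) (hq : q ≤ N)
    {i j : Fin (m + 3)} (hi : (i, p) ≠ (0, 0)) (hj : (j, q) ≠ (0, 0)) (hij : i ≠ j) :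
    NearComm S ((2 * q + 1) * ((6 * N + 7) * U)) (adj i p) (starWord j q) := by
  by_cases hj0 : j = 0
  · subst hj0
    have hq' : 1 ≤ q := Nat.one_le_iff_ne_zero.2 fun h => hj (by rw [h])
    have h0 : NearComm S ((6 * N + 7) * U) (adj i p) (starWord 0 1) := by
      rw [star_zero_one]
      exact adj_comm_adj H hp (by omega) (.inl hij)
    refine (h0.star_of_le (by simp) hq' fun r _ hr =>
      adj_comm_adj H hp (by omega) (.inl hij)).mono ?_
    rw [add_comm, ← Nat.succ_mul]
    exact Nat.mul_le_mul_right _ (by omega)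
  · have h0 : NearComm S ((6 * N + 7) * U) (adj i p) (starWord j 0) := by
      by_cases hi0 : i = 0
      · subst hi0
        obtain ⟨p, rfl⟩ := Nat.exists_eq_succ_of_ne_zero fun h : p = 0 => hi (by rw [h])
        exact (adj_succ_comm_of_corner H (p := p) (by omega) hij (short_corner _ _)
          (wordPerm_corner hij)).comm.mono (Nat.mul_le_mul_right _ (by omega))
      · exact (adj_comm_corner H hp (Ne.symm hj0) (Ne.symm hi0) hij.symm).comm.mono
          (Nat.le_mul_of_pos_left _ (by omega))
    refine (h0.star_of_le (by simpa using hj0) (Nat.zero_le q) fun r _ hr =>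
      adj_comm_adj H hp (by omega) (.inl hij)).mono ?_
    rw [add_comm, ← Nat.succ_mul]
    exact Nat.mul_le_mul_right _ (by omega)

theorem adj_comm_star_of_lt (H : LevelCost N U) {p q : ℕ} (hp : p ≤ N) (hq : q < p)
    {i : Fin (m + 3)} (hi : (i, q) ≠ (0, 0)) :
    NearComm S ((2 * q + 1) * ((6 * N + 7) * U)) (adj i p) (starWord i q) := by
  by_cases hi0 : i = 0
  · subst hi0
    have hq' : 1 ≤ q := Nat.one_le_iff_ne_zero.2 fun h => hi (by rw [h])
    have h0 : NearComm S ((6 * N + 7) * U) (adj 0 p) (starWord 0 1) := by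
      rw [star_zero_one]
      exact adj_comm_adj H hp (by omega) (.inr (.inr (by omega)))
    refine (h0.star_of_le (by simp) hq' fun r _ hr =>
      adj_comm_adj H hp (by omega) (.inr (.inr (by omega)))).mono ?_
    rw [add_comm, ← Nat.succ_mul]
    exact Nat.mul_le_mul_right _ (by omega)
  · have h0 : NearComm S ((6 * N + 7) * U) (adj i p) (starWord i 0) := by
      obtain ⟨p, rfl⟩ := Nat.exists_eq_succ_of_ne_zero fun h : p = 0 => by omega
      exact (adj_succ_comm_of_corner H (p := p) (by omega) hi0 (short_corner _ _)
        (by rw [wordPerm_corner (Ne.symm hi0), Equiv.swap_comm])).comm.mono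
          (Nat.mul_le_mul_right _ (by omega))
    refine (h0.star_of_le (by simpa using hi0) (Nat.zero_le q) fun r _ hr =>
      adj_comm_adj H hp (by omega) (.inr (.inr (by omega)))).mono ?_
    rw [add_comm, ← Nat.succ_mul]
    exact Nat.mul_le_mul_right _ (by omega)

/-- Here `adj i p` does not commute with every letter of the star. But `adj i (p + 1) * adj i p`
carries the star at `p` to the star at `p + 2` and, by the braid relation, carries `adj i (p + 1)`,
which commutes with the star at `p`, to `adj i p`. -/
theorem adj_comm_star_of_gt (H : LevelCost N U) {p d : ℕ} (hp : p + 2 + d ≤ N)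
    {i : Fin (m + 3)} (hi : (i, p) ≠ (0, 0)) :
    NearComm S ((2 * (p + d) + 3) * ((6 * N + 7) * U)) (adj i p) (starWord i (p + 2 + d)) := by
  have h1 := adj_comm_star_of_lt H (p := p + 1) (by omega) (Nat.lt_succ_self p) hi
  have h2 : Cj S ((6 * N + 7) * U) (adj i (p + 1) * adj i p) (adj i (p + 1)) (adj i p) := by
    have h3 := (adj_braid H (p := p) (by omega) i).near.symm
    have h4 : Cj S ((6 * p + 1) * U) (adj i (p + 1) * adj i p) (adj i (p + 1)) (adj i p) := by
      simpa [Cj, mul_assoc] using h3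
    exact h4.mono (Nat.mul_le_mul_right _ (by omega))
  have h3 : Cj S 0 (adj i (p + 1) * adj i p) (starWord i p) (starWord i (p + 2)) := by
    refine Cj.of_eq ?_
    rw [star_succ (p := p + 1) (by simp), star_succ hi]
    group
  refine (NearComm.star_of_le (by simp) (h1.transport h2 h3 h3) (Nat.le_add_right (p + 2) d)
    fun r hr hr' => adj_comm_adj H (by omega) (by omega) (.inr (.inl (by omega)))).mono ?_
  rw [show p + 2 + d - (p + 2) = d by omega]
  apply le_of_eq
  ring

/-- The word `star` at a point. -/
def starAt (y : Fin (m + 3) × ℕ) : FreeGroup (HGen m) := starWord y.1 y.2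

/-- The adjacent transpositions permute the words `star`. -/
theorem adj_conj_starAt (H : LevelCost N U) {i : Fin (m + 3)} {p : ℕ} {y : Fin (m + 3) × ℕ}
    (hp : p ≤ N) (hy2 : y.2 ≤ N) (hi : (i, p) ≠ (0, 0)) (hy : y ≠ (0, 0)) :
    Cj S ((2 * N + 3) * ((6 * N + 7) * U)) (adj i p) (starAt y)
      (starAt (Equiv.swap (i, p) (i, p + 1) y)) := by
  obtain ⟨j, q⟩ := y
  have hU := H.pos
  have hpos : 2 ≤ (2 * N + 3) * ((6 * N + 7) * U) := by
    have : 3 * (7 * 5) ≤ (2 * N + 3) * ((6 * N + 7) * U) :=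
      Nat.mul_le_mul (by omega) (Nat.mul_le_mul (by omega) hU)
    omega
  by_cases hij : i = j
  · subst hij
    rcases lt_trichotomy q p with h | rfl | h
    · rw [Equiv.swap_apply_of_ne_of_ne (by simp; omega) (by simp; omega)]
      exact (adj_comm_star_of_lt H hp h hy).mono (Nat.mul_le_mul_right _ (by omega))
    · rw [Equiv.swap_apply_left]
      refine (Cj.of_eq ?_ : Cj S 0 _ _ _).mono (by omega)
      rw [starAt, starAt, star_succ hy]
    · obtain rfl | h' := eq_or_lt_of_le (Nat.succ_le_of_lt h)
      · rw [Nat.succ_eq_add_one, Equiv.swap_apply_right]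
        have h1 : Cj S 0 (adj i p) (starWord i p) (starWord i (p + 1)) := Cj.of_eq (star_succ hi).symm
        exact (h1.inv.congr_conj (adj_near_inv i p)).mono (by omega)
      · rw [Equiv.swap_apply_of_ne_of_ne (by simp; omega) (by simp; omega)]
        obtain ⟨d, rfl⟩ := Nat.exists_eq_add_of_le (Nat.succ_le_of_lt h')
        simp only [Nat.succ_eq_add_one, add_assoc, Nat.reduceAdd] at hy2 ⊢
        rw [← add_assoc] at hy2
        have := adj_comm_star_of_gt H hy2 hi
        rw [add_assoc] at this
        exact this.mono (Nat.mul_le_mul_right _ (by omega))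
  · rw [Equiv.swap_apply_of_ne_of_ne (by simp [Ne.symm hij]) (by simp [Ne.symm hij])]
    exact (adj_comm_star_of_ne H hp hy2 hi hy hij).mono (Nat.mul_le_mul_right _ (by simp at hy2; omega))

end StarTranspositions

/-! ### Relations between stars; words for arbitrary transpositions -/

section Transpositions

variable {m : ℕ}

local notation "S" => shortRelators m

/-- The adjacent transpositions up to level `N` permute the words `starWord` at cost `Z`. -/
structure AdjCost (m N Z : ℕ) : Prop where
  one_le : 1 ≤ Z
  conj : ∀ (i : Fin (m + 3)) (p : ℕ) (y : Fin (m + 3) × ℕ), p ≤ N → y.2 ≤ N → (i, p) ≠ (0, 0) →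
    y ≠ (0, 0) → Cj (shortRelators m) Z (adj i p) (starAt y)
      (starAt (Equiv.swap (i, p) (i, p + 1) y))

variable {N Z : ℕ}

theorem starAt_mul_self {y : Fin (m + 3) × ℕ} (hy : y ≠ (0, 0)) :
    FillsWithin S 1 (starAt y * starAt y) := by
  obtain ⟨i, p⟩ := y
  rw [starAt]
  induction p with
  | zero =>
    have hi : (0 : Fin (m + 3)) ≠ i := fun h => hy (by rw [h])
    refine (near_of_short (y := 1) ((short_corner 0 i).mul (short_corner 0 i)) (l := 0) ?_
      (by omega) ?_).fillsWithin
    · simp [Short]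
    · simp [wordPerm_corner hi]
  | succ p ih =>
    by_cases h : (i, p) = (0, 0)
    · obtain ⟨rfl, rfl⟩ := Prod.mk.inj h
      rw [star_zero_one]
      exact adj_mul_self 0 0
    · convert (ih h).conj (adj i p) using 1
      rw [star_succ h]
      group

/-- Three points cannot fill four consecutive places, so below a point of height at least 4 there is
a gap into which some point can slide. Since `1 ≤ p`, the slide never touches the base point. -/
theorem exists_movable (A : Finset (Fin (m + 3) × ℕ)) (hA : A.card ≤ 3) {y : Fin (m + 3) × ℕ}
    (hy : y ∈ A) (hy3 : 3 < y.2) : ∃ i p, 1 ≤ p ∧ (i, p) ∉ A ∧ (i, p + 1) ∈ A := by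
  obtain ⟨i, q⟩ := y
  obtain ⟨r, rfl⟩ : ∃ r, q = r + 4 := ⟨q - 4, by simp at hy3; omega⟩
  by_contra! h
  have h3 : (i, r + 3) ∈ A := by_contra fun h' => h i (r + 3) (by omega) h' hy
  have h2 : (i, r + 2) ∈ A := by_contra fun h' => h i (r + 2) (by omega) h' h3
  have h1 : (i, r + 1) ∈ A := by_contra fun h' => h i (r + 1) (by omega) h' h2
  have hsub : ({(i, r + 1), (i, r + 2), (i, r + 3), (i, r + 4)} : Finset (Fin (m + 3) × ℕ)) ⊆ A := by
    intro z hz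
    simp only [Finset.mem_insert, Finset.mem_singleton] at hz
    rcases hz with rfl | rfl | rfl | rfl <;> assumption
  have hc := Finset.card_le_card hsub
  have h4 : ({(i, r + 1), (i, r + 2), (i, r + 3), (i, r + 4)} :
      Finset (Fin (m + 3) × ℕ)).card = 4 := by
    rw [Finset.card_insert_of_notMem (by simp), Finset.card_insert_of_notMem (by simp),
      Finset.card_insert_of_notMem (by simp), Finset.card_singleton]
  omega

theorem swap_snd_le {i : Fin (m + 3)} {p : ℕ} {y : Fin (m + 3) × ℕ} (h : y ≠ (i, p)) :
    (Equiv.swap (i, p) (i, p + 1) y).2 ≤ y.2 := by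
  by_cases h' : y = (i, p + 1)
  · simp [h']
  · rw [Equiv.swap_apply_of_ne_of_ne h h']

theorem swap_ne_zero {i : Fin (m + 3)} {p : ℕ} {y : Fin (m + 3) × ℕ} (hp : (i, p) ≠ (0, 0))
    (hy : y ≠ (0, 0)) : Equiv.swap (i, p) (i, p + 1) y ≠ (0, 0) := by
  intro h
  have h1 := congrArg (Equiv.swap (i, p) (i, p + 1)) h
  rw [Equiv.swap_apply_self, Equiv.swap_apply_of_ne_of_ne hp.symm (by simp)] at h1
  exact hy h1

/-- The backwards move of a point. -/
theorem AdjCost.conj' (H : AdjCost m N Z) {i : Fin (m + 3)} {p : ℕ} {y : Fin (m + 3) × ℕ}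
    (hp : p ≤ N) (hy2 : y.2 ≤ N) (h : y ≠ (i, p)) (hi : (i, p) ≠ (0, 0)) (hy : y ≠ (0, 0)) :
    Cj S Z (adj i p) (starAt (Equiv.swap (i, p) (i, p + 1) y)) (starAt y) := by
  have := H.conj i p _ hp ((swap_snd_le h).trans hy2) hi (swap_ne_zero hi hy)
  rwa [Equiv.swap_apply_self] at this

theorem short_starAt {y : Fin (m + 3) × ℕ} (hy : y.2 ≤ 3) : Short 37 (starAt y) := by
  refine (short_star y.1 y.2).mono ?_
  nlinarith

theorem wordPerm_starAt {y : Fin (m + 3) × ℕ} (hy : y ≠ (0, 0)) :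
    wordPerm m (starAt y) = Equiv.swap (0, 0) y :=
  wordPerm_star hy

/-- Sliding a point into a gap below it is conjugation by some `adj i p` and lowers the sum of
heights. With all heights at most 3 the relation is a short relator. -/
theorem starAt_braid_aux (H : AdjCost m N Z) (s : ℕ) : ∀ a b : Fin (m + 3) × ℕ, a.2 + b.2 ≤ s →
    a.2 ≤ N → b.2 ≤ N → a ≠ (0, 0) → b ≠ (0, 0) → a ≠ b →
    Cj S (8 * Z * s + 1) (starAt a * starAt b) (starAt a) (starAt b) := by
  induction s using Nat.strong_induction_on with
  | _ s ih =>
  intro a b hs haN hbN ha hb hab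
  by_cases h3 : a.2 ≤ 3 ∧ b.2 ≤ 3
  · refine (cj_of_short ((short_starAt h3.1).mul (short_starAt h3.2)) (short_starAt h3.1)
      (short_starAt h3.2) (by omega) (0, 0) a (wordPerm_starAt ha) ?_).mono (by omega)
    rw [map_mul, wordPerm_starAt ha, wordPerm_starAt hb, Equiv.Perm.mul_apply,
      Equiv.Perm.mul_apply, Equiv.swap_apply_left, Equiv.swap_apply_of_ne_of_ne ha hab,
      Equiv.swap_apply_of_ne_of_ne hb hab.symm, Equiv.swap_apply_right, Equiv.swap_comm]
  · obtain ⟨i, p, hp, hp1, hp2⟩ : ∃ i p, 1 ≤ p ∧ (i, p) ∉ ({a, b} : Finset _) ∧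
        (i, p + 1) ∈ ({a, b} : Finset (Fin (m + 3) × ℕ)) := by
      by_cases h : a.2 ≤ 3
      · exact exists_movable _ (Finset.card_le_two.trans (by omega)) (y := b) (by simp) (by omega)
      · exact exists_movable _ (Finset.card_le_two.trans (by omega)) (y := a) (by simp) (by omega)
    simp only [Finset.mem_insert, Finset.mem_singleton, not_or] at hp1 hp2
    have hi : (i, p) ≠ (0, 0) := by simp; omega
    have ha' := swap_snd_le (Ne.symm hp1.1)
    have hb' := swap_snd_le (Ne.symm hp1.2)
    have hpN : p ≤ N := by
      rcases hp2 with h | h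
      · rw [← h] at haN; simp at haN; omega
      · rw [← h] at hbN; simp at hbN; omega
    have hlt : (Equiv.swap (i, p) (i, p + 1) a).2 + (Equiv.swap (i, p) (i, p + 1) b).2 < s := by
      rcases hp2 with h | h
      · have : (Equiv.swap (i, p) (i, p + 1) a).2 < a.2 := by simp [← h]
        omega
      · have : (Equiv.swap (i, p) (i, p + 1) b).2 < b.2 := by simp [← h]
        omega
    have h1 := ih (s - 1) (by omega) _ _ (Nat.le_sub_one_of_lt hlt) (ha'.trans haN) (hb'.trans hbN)
      (swap_ne_zero hi ha) (swap_ne_zero hi hb) (by simpa using hab)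
    have hca := H.conj' hpN haN (Ne.symm hp1.1) hi ha
    have hcb := H.conj' hpN hbN (Ne.symm hp1.2) hi hb
    refine (h1.transport (hca.mul hcb) hca hcb).mono ?_
    obtain ⟨s, rfl⟩ : ∃ t, s = t + 1 := ⟨s - 1, by omega⟩
    rw [Nat.add_sub_cancel]
    linarith

/-- The same descent with three points. A slide conjugates the three-letter conjugator at price `3 *
Z`, counted twice, and both copies of the star at `c`: `8 * Z` in all. -/
theorem starAt_comm_aux (H : AdjCost m N Z) (s : ℕ) : ∀ a b c : Fin (m + 3) × ℕ,
    a.2 + b.2 + c.2 ≤ s → a.2 ≤ N → b.2 ≤ N → c.2 ≤ N → a ≠ (0, 0) → b ≠ (0, 0) → c ≠ (0, 0) →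
    a ≠ b → a ≠ c → b ≠ c →
    NearComm S (8 * Z * s + 1) (starAt a * starAt b * starAt a) (starAt c) := by
  induction s using Nat.strong_induction_on with
  | _ s ih =>
  intro a b c hs haN hbN hcN ha hb hc hab hac hbc
  by_cases h3 : a.2 ≤ 3 ∧ b.2 ≤ 3 ∧ c.2 ≤ 3
  · refine (cj_of_short (((short_starAt h3.1).mul (short_starAt h3.2.1)).mul (short_starAt h3.1))
      (short_starAt h3.2.2) (short_starAt h3.2.2) (by omega) (0, 0) c (wordPerm_starAt hc)
      ?_).mono (by omega)
    rw [map_mul, map_mul, wordPerm_starAt ha, wordPerm_starAt hb, wordPerm_starAt hc,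
      Equiv.Perm.mul_apply, Equiv.Perm.mul_apply, Equiv.Perm.mul_apply, Equiv.Perm.mul_apply,
      Equiv.swap_apply_left, Equiv.swap_apply_of_ne_of_ne ha hab,
      Equiv.swap_apply_right, Equiv.swap_apply_of_ne_of_ne hc hac.symm,
      Equiv.swap_apply_of_ne_of_ne hc hbc.symm, Equiv.swap_apply_of_ne_of_ne hc hac.symm]
  · obtain ⟨i, p, hp, hp1, hp2⟩ : ∃ i p, 1 ≤ p ∧ (i, p) ∉ ({a, b, c} : Finset _) ∧
        (i, p + 1) ∈ ({a, b, c} : Finset (Fin (m + 3) × ℕ)) := by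
      by_cases h : a.2 ≤ 3
      · by_cases h' : b.2 ≤ 3
        · exact exists_movable _ Finset.card_le_three (y := c) (by simp) (by omega)
        · exact exists_movable _ Finset.card_le_three (y := b) (by simp) (by omega)
      · exact exists_movable _ Finset.card_le_three (y := a) (by simp) (by omega)
    simp only [Finset.mem_insert, Finset.mem_singleton, not_or] at hp1 hp2
    have hi : (i, p) ≠ (0, 0) := by simp; omega
    have ha' := swap_snd_le (Ne.symm hp1.1)
    have hb' := swap_snd_le (Ne.symm hp1.2.1)
    have hc' := swap_snd_le (Ne.symm hp1.2.2)
    have hpN : p ≤ N := by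
      rcases hp2 with h | h | h
      · rw [← h] at haN; simp at haN; omega
      · rw [← h] at hbN; simp at hbN; omega
      · rw [← h] at hcN; simp at hcN; omega
    have hlt : (Equiv.swap (i, p) (i, p + 1) a).2 + (Equiv.swap (i, p) (i, p + 1) b).2 +
        (Equiv.swap (i, p) (i, p + 1) c).2 < s := by
      rcases hp2 with h | h | h
      · have : (Equiv.swap (i, p) (i, p + 1) a).2 < a.2 := by simp [← h]
        omega
      · have : (Equiv.swap (i, p) (i, p + 1) b).2 < b.2 := by simp [← h]
        omega
      · have : (Equiv.swap (i, p) (i, p + 1) c).2 < c.2 := by simp [← h]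
        omega
    have h1 := ih (s - 1) (by omega) _ _ _ (Nat.le_sub_one_of_lt hlt) (ha'.trans haN)
      (hb'.trans hbN) (hc'.trans hcN) (swap_ne_zero hi ha) (swap_ne_zero hi hb)
      (swap_ne_zero hi hc) (by simpa using hab) (by simpa using hac) (by simpa using hbc)
    have hca := H.conj' hpN haN (Ne.symm hp1.1) hi ha
    have hcb := H.conj' hpN hbN (Ne.symm hp1.2.1) hi hb
    have hcc := H.conj' hpN hcN (Ne.symm hp1.2.2) hi hc
    refine (h1.transport ((hca.mul hcb).mul hca) hcc hcc).mono ?_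
    obtain ⟨s, rfl⟩ : ∃ t, s = t + 1 := ⟨s - 1, by omega⟩
    rw [Nat.add_sub_cancel]
    linarith

theorem starAt_braid (H : AdjCost m N Z) {a b : Fin (m + 3) × ℕ} (haN : a.2 ≤ N) (hbN : b.2 ≤ N)
    (ha : a ≠ (0, 0)) (hb : b ≠ (0, 0)) (hab : a ≠ b) :
    Cj S (24 * N * Z + 1) (starAt a * starAt b) (starAt a) (starAt b) :=
  (starAt_braid_aux H (3 * N) a b (by omega) haN hbN ha hb hab).mono (by apply le_of_eq; ring)

theorem starAt_comm (H : AdjCost m N Z) {a b c : Fin (m + 3) × ℕ} (haN : a.2 ≤ N) (hbN : b.2 ≤ N)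
    (hcN : c.2 ≤ N) (ha : a ≠ (0, 0)) (hb : b ≠ (0, 0)) (hc : c ≠ (0, 0)) (hab : a ≠ b)
    (hac : a ≠ c) (hbc : b ≠ c) :
    NearComm S (24 * N * Z + 1) (starAt a * starAt b * starAt a) (starAt c) :=
  (starAt_comm_aux H (3 * N) a b c (by omega) haN hbN hcN ha hb hc hab hac hbc).mono
    (by apply le_of_eq; ring)

/-- The word for the transposition of two points. -/
def transp (a b : Fin (m + 3) × ℕ) : FreeGroup (HGen m) :=
  if b = (0, 0) then starAt a else if a = (0, 0) then starAt b
  else starAt a * starAt b * starAt a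

theorem transp_zero_right (a : Fin (m + 3) × ℕ) : transp (m := m) a (0, 0) = starAt a := by
  simp [transp]

theorem transp_zero_left {b : Fin (m + 3) × ℕ} (hb : b ≠ (0, 0)) :
    transp (m := m) (0, 0) b = starAt b := by
  simp [transp, hb]

theorem transp_of_ne {a b : Fin (m + 3) × ℕ} (ha : a ≠ (0, 0)) (hb : b ≠ (0, 0)) :
    transp (m := m) a b = starAt a * starAt b * starAt a := by
  simp [transp, ha, hb]

theorem wordPerm_transp {a b : Fin (m + 3) × ℕ} (hab : a ≠ b) :
    wordPerm m (transp a b) = Equiv.swap a b := by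
  by_cases hb : b = (0, 0)
  · subst hb
    rw [transp_zero_right, wordPerm_starAt hab, Equiv.swap_comm]
  by_cases ha : a = (0, 0)
  · subst ha
    rw [transp_zero_left hb, wordPerm_starAt hb]
  · rw [transp_of_ne ha hb, map_mul, map_mul, wordPerm_starAt ha, wordPerm_starAt hb]
    rw [show Equiv.swap (0, 0) a * Equiv.swap (0, 0) b * Equiv.swap (0, 0) a =
      Equiv.swap (0, 0) a * Equiv.swap (0, 0) b * (Equiv.swap (0, 0) a)⁻¹ by rw [Equiv.swap_inv],
      mul_swap_mul_inv, Equiv.swap_apply_left, Equiv.swap_apply_of_ne_of_ne hb hab.symm]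

theorem short_transp {a b : Fin (m + 3) × ℕ} (ha : a.2 ≤ 3) (hb : b.2 ≤ 3) :
    Short 111 (transp a b) := by
  have h1 := short_starAt (m := m) ha
  have h2 := short_starAt (m := m) hb
  rw [transp]
  split_ifs
  · exact h1.mono (by omega)
  · exact h2.mono (by omega)
  · exact (h1.mul h2).mul h1

theorem transp_mul_self {a b : Fin (m + 3) × ℕ} (hab : a ≠ b) :
    FillsWithin S 3 (transp a b * transp a b) := by
  by_cases hb : b = (0, 0)
  · subst hb
    rw [transp_zero_right]
    exact (starAt_mul_self hab).mono (by omega)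
  by_cases ha : a = (0, 0)
  · subst ha
    rw [transp_zero_left hb]
    exact (starAt_mul_self hb).mono (by omega)
  · rw [transp_of_ne ha hb]
    have h1 := (starAt_mul_self ha).conj (starAt a * starAt b)
    have h2 := (starAt_mul_self hb).conj (starAt a)
    convert h1.mul (h2.mul (starAt_mul_self ha)) using 1
    group

end Transpositions

/-! ### Conjugation among transpositions -/

section TranspositionRules

variable {m : ℕ}

local notation "S" => shortRelators m

variable {N Z : ℕ}

theorem starAt_near_inv {y : Fin (m + 3) × ℕ} (hy : y ≠ (0, 0)) :
    Near S 1 (starAt y) (starAt y)⁻¹ := by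
  simpa [Near] using starAt_mul_self hy

theorem transp_near_symm (H : AdjCost m N Z) {a b : Fin (m + 3) × ℕ} (haN : a.2 ≤ N)
    (hbN : b.2 ≤ N) (hab : a ≠ b) : Near S (24 * N * Z + 1) (transp a b) (transp b a) := by
  by_cases hb : b = (0, 0)
  · subst hb
    rw [transp_zero_right, transp_zero_left hab]
    exact (Near.refl _).mono (by omega)
  by_cases ha : a = (0, 0)
  · subst ha
    rw [transp_zero_left hb, transp_zero_right]
    exact (Near.refl _).mono (by omega)
  · rw [transp_of_ne ha hb, transp_of_ne hb ha]
    simpa [Cj, mul_assoc] using (starAt_braid H haN hbN ha hb hab).near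

theorem adj_conj_transp (H : AdjCost m N Z) {i : Fin (m + 3)} {p : ℕ} {a b : Fin (m + 3) × ℕ}
    (hp : p ≤ N) (haN : a.2 ≤ N) (hbN : b.2 ≤ N) (hi : (i, p) ≠ (0, 0)) (hab : a ≠ b) :
    Cj S (3 * Z) (adj i p) (transp a b)
      (transp (Equiv.swap (i, p) (i, p + 1) a) (Equiv.swap (i, p) (i, p + 1) b)) := by
  have h0 : Equiv.swap (i, p) (i, p + 1) (0, 0) = (0, 0) :=
    Equiv.swap_apply_of_ne_of_ne hi.symm (by simp)
  by_cases hb : b = (0, 0)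
  · subst hb
    rw [h0, transp_zero_right, transp_zero_right]
    exact (H.conj i p a hp haN hi hab).mono (by omega)
  by_cases ha : a = (0, 0)
  · subst ha
    rw [h0, transp_zero_left hb, transp_zero_left (swap_ne_zero hi hb)]
    exact (H.conj i p b hp hbN hi hb).mono (by omega)
  · rw [transp_of_ne ha hb, transp_of_ne (swap_ne_zero hi ha) (swap_ne_zero hi hb)]
    have h1 := H.conj i p a hp haN hi ha
    have h2 := H.conj i p b hp hbN hi hb
    exact ((h1.mul h2).mul h1).mono (by omega)

/-- If `a`, `b`, `c` and the base point are all distinct, this is the commutation of stars;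
otherwise it reduces to the braid relation, to squares of stars, or to a free identity. -/
theorem starAt_conj_transp (H : AdjCost m N Z) {a b c : Fin (m + 3) × ℕ} (haN : a.2 ≤ N)
    (hbN : b.2 ≤ N) (hcN : c.2 ≤ N) (hc : c ≠ (0, 0)) (hab : a ≠ b) :
    Cj S (24 * N * Z + 3) (starAt c) (transp a b)
      (transp (Equiv.swap (0, 0) c a) (Equiv.swap (0, 0) c b)) := by
  have hinv := starAt_near_inv hc
  by_cases hb : b = (0, 0)
  · subst hb
    rw [Equiv.swap_apply_left]
    by_cases hac : a = c
    · subst hac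
      rw [Equiv.swap_apply_right, transp_zero_right, transp_zero_left hc]
      exact (Cj.of_eq (by group) : Cj S 0 _ _ _).mono (by omega)
    · rw [Equiv.swap_apply_of_ne_of_ne hab hac, transp_zero_right, transp_of_ne hab hc]
      have h1 := (starAt_braid H hcN haN hc hab (Ne.symm hac)).near
      have h2 := (starAt_mul_self hab).conj (starAt a * starAt c)
      have h3 : Near S (24 * N * Z + 1 + 1) (starAt c * starAt a)
          (starAt a * starAt c * starAt a * starAt c) := by
        have h4 : Near S (24 * N * Z + 1) (starAt a * starAt c * starAt a * starAt c)
            (starAt c * starAt a * (starAt c * starAt c)) := by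
          have := Near.mul_right h1.symm (starAt c)
          simpa [mul_assoc] using this
        have h5 : Near S 1 (starAt c * starAt a * (starAt c * starAt c)) (starAt c * starAt a) := by
          have : Near S 1 (starAt c * starAt c) 1 := by simpa [Near] using starAt_mul_self hc
          simpa using this.mul_left (starAt c * starAt a)
        exact (h4.trans h5).symm
      exact h3.mono (by omega)
  by_cases ha : a = (0, 0)
  · subst ha
    rw [Equiv.swap_apply_left, transp_zero_left hb]
    by_cases hbc : b = c
    · subst hbc
      rw [Equiv.swap_apply_right, transp_zero_right]
      exact (Cj.of_eq (by group) : Cj S 0 _ _ _).mono (by omega)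
    · rw [Equiv.swap_apply_of_ne_of_ne hb hbc, transp_of_ne hc hb]
      have h1 := (Near.mul_left (starAt c * starAt b)
        (show Near S 1 (starAt c * starAt c) 1 by simpa [Near] using starAt_mul_self hc)).symm
      have h2 : Cj S 1 (starAt c) (starAt b) (starAt c * starAt b * starAt c) := by
        simpa [Cj, mul_assoc] using h1
      exact h2.mono (by omega)
  rw [transp_of_ne ha hb]
  by_cases hac : a = c
  · subst hac
    rw [Equiv.swap_apply_right, Equiv.swap_apply_of_ne_of_ne hb hab.symm, transp_zero_left hb]
    have h1 := Near.mul_right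
      (show Near S 1 (starAt a * starAt a) 1 by simpa [Near] using starAt_mul_self hc)
      (starAt b * starAt a)
    have h2 : Cj S 1 (starAt a) (starAt a * starAt b * starAt a) (starAt b) := by
      simpa [Cj, mul_assoc] using h1
    exact h2.mono (by omega)
  by_cases hbc : b = c
  · subst hbc
    rw [Equiv.swap_apply_right, Equiv.swap_apply_of_ne_of_ne ha hab, transp_zero_right]
    have h1 := (starAt_braid H haN hbN ha hc hab).near
    have h2 := (h1.symm.mul_right (starAt a))
    have h3 := Near.mul_left (starAt a * starAt b)
      (show Near S 1 (starAt a * starAt a) 1 by simpa [Near] using starAt_mul_self ha)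
    have h4 : Near S (24 * N * Z + 1) (starAt b * (starAt a * starAt b * starAt a))
        (starAt a * starAt b * (starAt a * starAt a)) := by
      simpa [mul_assoc] using h2
    rw [mul_one] at h3
    exact (h4.trans h3).mono (by omega)
  · rw [Equiv.swap_apply_of_ne_of_ne ha hac, Equiv.swap_apply_of_ne_of_ne hb hbc,
      transp_of_ne ha hb]
    exact (starAt_comm H haN hbN hcN ha hb hc hab hac hbc).comm.mono (by omega)

theorem swap_zero_snd_le {c y : Fin (m + 3) × ℕ} (hc : c.2 ≤ N) (hy : y.2 ≤ N) :
    (Equiv.swap (0, 0) c y).2 ≤ N := by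
  rw [Equiv.swap_apply_def]
  split_ifs
  · exact hc
  · exact Nat.zero_le _
  · exact hy

/-- The words `transp` conjugate each other like transpositions. -/
theorem transp_conj_transp (H : AdjCost m N Z) {a b c d : Fin (m + 3) × ℕ} (haN : a.2 ≤ N)
    (hbN : b.2 ≤ N) (hcN : c.2 ≤ N) (hdN : d.2 ≤ N) (hab : a ≠ b) (hcd : c ≠ d) :
    Cj S (72 * N * Z + 9) (transp c d) (transp a b)
      (transp (Equiv.swap c d a) (Equiv.swap c d b)) := by
  by_cases hd : d = (0, 0)
  · subst hd
    rw [transp_zero_right, Equiv.swap_comm]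
    exact (starAt_conj_transp H haN hbN hcN hcd hab).mono (by ring_nf; omega)
  by_cases hc : c = (0, 0)
  · subst hc
    rw [transp_zero_left hd]
    exact (starAt_conj_transp H haN hbN hdN hd hab).mono (by ring_nf; omega)
  · have h1 := starAt_conj_transp H haN hbN hcN hc hab
    have h2 := starAt_conj_transp H (swap_zero_snd_le hcN haN) (swap_zero_snd_le hcN hbN) hdN hd
      (by simpa using hab)
    have h3 := starAt_conj_transp H (swap_zero_snd_le hdN (swap_zero_snd_le hcN haN))
      (swap_zero_snd_le hdN (swap_zero_snd_le hcN hbN)) hcN hc (by simpa using hab)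
    have h4 := h1.comp (h2.comp h3)
    have h5 : ∀ y, Equiv.swap (0, 0) c (Equiv.swap (0, 0) d (Equiv.swap (0, 0) c y)) =
        Equiv.swap c d y := by
      intro y
      have h6 := mul_swap_mul_inv (Equiv.swap (0, 0) c) (0, 0) d
      rw [Equiv.swap_apply_left, Equiv.swap_apply_of_ne_of_ne hd (Ne.symm hcd),
        Equiv.swap_inv] at h6
      rw [← h6]
      rfl
    rw [h5, h5] at h4
    rw [transp_of_ne hc hd]
    exact h4.mono (by ring_nf; omega)

end TranspositionRules

/-! ### Conjugation of transpositions by translations -/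

section TranslationRules

variable {m : ℕ}

local notation "S" => shortRelators m

variable {N U Z : ℕ}

/-- The level is at least 1, because the shift would tear the two lowest points of its source ray
onto different rays. -/
theorem transl_conj_adj_exists (H : LevelCost N U) {l k : Fin (m + 3)} (hlk : l ≠ k)
    (i : Fin (m + 3)) {p : ℕ} (hp : p + 1 ≤ N) :
    ∃ p', p ≤ p' ∧ p' ≤ p + 2 ∧ shift l k (i, p + 1) = (i, p') ∧
      shift l k (i, p + 2) = (i, p' + 1) ∧ Cj S U (transl l k) (adj i (p + 1)) (adj i p') := by
  by_cases hil : i = l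
  · subst hil
    exact ⟨p, by omega, by omega, shift_apply_succ _ _ hlk _, shift_apply_succ _ _ hlk _,
      transl_conj_adj_succ H (by omega) hlk.symm⟩
  by_cases hik : i = k
  · subst hik
    exact ⟨p + 2, by omega, by omega, shift_apply_target _ _ hlk _, shift_apply_target _ _ hlk _,
      transl_conj_adj H hp hlk⟩
  · exact ⟨p + 1, by omega, by omega, shift_apply_of_ne _ _ _ hil hik _,
      shift_apply_of_ne _ _ _ hil hik _, adj_comm_transl H hp (Ne.symm hil) (Ne.symm hik)⟩

/-- A translation may move the base point, so a star becomes a general transposition. Conjugating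
the recursion for `starWord` climbs one level at price `2 * U + 3 * Z`, at most `5 * Z`. -/
theorem transl_conj_starAt (H : LevelCost N U) (HZ : AdjCost m N Z) (hUZ : U ≤ Z)
    {l k : Fin (m + 3)} (hlk : l ≠ k) (i : Fin (m + 3)) (p : ℕ) (hp : p + 1 ≤ N) (hN : 1 ≤ N)
    (hy : (i, p) ≠ (0, 0)) :
    Cj S (5 * Z * p + 1) (transl l k) (starAt (i, p))
      (transp (shift l k (0, 0)) (shift l k (i, p))) := by
  have hsmall : ∀ q, q ≤ 2 → (i, q) ≠ (0, 0) → Cj S 1 (transl l k) (starAt (i, q))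
      (transp (shift l k (0, 0)) (shift l k (i, q))) := by
    intro q hq hi
    refine cj_of_short (short_transl _ _) (short_starAt (by simp; omega))
      (short_transp ((shift_snd_le l k (0, 0)).trans (by simp))
        ((shift_snd_le l k (i, q)).trans (by simp; omega))) (by omega) (0, 0) (i, q)
      (wordPerm_starAt hi) ?_
    rw [wordPerm_transp (by simpa using hi.symm), wordPerm_transl]
  induction p with
  | zero => exact (hsmall 0 (by omega) hy).mono (by omega)
  | succ p ih =>
    rcases Nat.lt_or_ge p 2 with h2 | h2
    · exact (hsmall (p + 1) (by omega) hy).mono (by omega)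
    -- Heights up to 2 are covered by short relators, so here `1 ≤ r`. Hence `1 ≤ p'` and the
    -- shifted `adj i p'` avoids the base point.
    · obtain ⟨r, rfl⟩ : ∃ r, p = r + 1 := ⟨p - 1, by omega⟩
      obtain ⟨p', hp1, hp2, hs1, hs2, hc⟩ := transl_conj_adj_exists (m := m) H hlk i (p := r)
        (by omega)
      have hi : (i, r + 1) ≠ ((0, 0) : Fin (m + 3) × ℕ) := by simp
      have hi' : (i, p') ≠ ((0, 0) : Fin (m + 3) × ℕ) := by simp; omega
      have h3 := (hc.mul (ih (by omega) hi)).mul hc.inv_arg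
      rw [hs1] at h3
      have hne : shift l k (0, 0) ≠ (i, p') := by
        rw [← hs1]
        simp
      have hne' : shift l k (0, 0) ≠ (i, p' + 1) := by
        rw [← hs2]
        simp
      have h4 := adj_conj_transp HZ (i := i) (p := p') (a := shift l k (0, 0)) (b := (i, p'))
        (by omega) ((shift_snd_le l k (0, 0)).trans (by simpa using hN)) (by simp; omega) hi' hne
      rw [Equiv.swap_apply_left, Equiv.swap_apply_of_ne_of_ne hne hne'] at h4
      have h5 : Near S (3 * Z) (adj i p' * transp (shift l k (0, 0)) (i, p') * (adj i p')⁻¹)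
          (transp (shift l k (0, 0)) (i, p' + 1)) := by
        simpa [mul_assoc] using Near.mul_right h4.near (adj i p')⁻¹
      rw [hs2]
      have h6 : starAt (m := m) (i, r + 1 + 1) =
          adj i (r + 1) * starAt (i, r + 1) * (adj i (r + 1))⁻¹ := star_succ hi
      rw [h6]
      refine (h3.congr_target h5).mono ?_
      ring_nf
      omega

/-- The translations conjugate the words `transp` as they move points. -/
theorem transl_conj_transp (H : LevelCost N U) (HZ : AdjCost m N Z) (hUZ : U ≤ Z)
    {l k : Fin (m + 3)} (hlk : l ≠ k) {a b : Fin (m + 3) × ℕ} (ha2 : a.2 + 1 ≤ N)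
    (hb2 : b.2 + 1 ≤ N) (hab : a ≠ b) :
    Cj S (90 * N * Z + 20) (transl l k) (transp a b) (transp (shift l k a) (shift l k b)) := by
  have hN : 1 ≤ N := by omega
  have hst : ∀ y : Fin (m + 3) × ℕ, y.2 + 1 ≤ N → y ≠ (0, 0) → Cj S (5 * N * Z + 1) (transl l k)
      (starAt y) (transp (shift l k (0, 0)) (shift l k y)) := fun y hy2 hy =>
    (transl_conj_starAt H HZ hUZ hlk y.1 y.2 hy2 hN hy).mono (by
      have : 5 * Z * y.2 ≤ 5 * Z * N := Nat.mul_le_mul_left _ (by omega)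
      have h : 5 * N * Z = 5 * Z * N := by ring
      omega)
  have hsz : ∀ y : Fin (m + 3) × ℕ, y.2 + 1 ≤ N → (shift l k y).2 ≤ N := fun y hy2 =>
    (shift_snd_le l k y).trans hy2
  have h0 : ((0, 0) : Fin (m + 3) × ℕ).2 + 1 ≤ N := by simpa using hN
  by_cases hb : b = (0, 0)
  · subst hb
    rw [transp_zero_right]
    exact ((hst a ha2 hab).congr_target
      (transp_near_symm HZ (hsz _ h0) (hsz _ ha2) (by simpa using hab.symm))).mono
      (by ring_nf; omega)
  by_cases ha : a = (0, 0)
  · subst ha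
    rw [transp_zero_left hb]
    exact (hst b hb2 hb).mono (by ring_nf; omega)
  · have h1 := ((hst a ha2 ha).mul (hst b hb2 hb)).mul (hst a ha2 ha)
    have hne0a : shift l k (0, 0) ≠ shift l k a := by simpa using Ne.symm ha
    have hne0b : shift l k (0, 0) ≠ shift l k b := by simpa using Ne.symm hb
    have hneab : shift l k a ≠ shift l k b := by simpa using hab
    -- The image of star, star, star is a product of three transpositions through the shifted base
    -- point; it contracts to the required one times a square.
    have h2 := transp_conj_transp HZ (hsz _ h0) (hsz _ hb2) (hsz _ h0) (hsz _ ha2) hne0b hne0a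
    rw [Equiv.swap_apply_left, Equiv.swap_apply_of_ne_of_ne hne0b.symm hneab.symm] at h2
    have h3 := h2.near.mul_right (transp (shift l k (0, 0)) (shift l k a))
    have h4 := Near.mul_left (transp (shift l k a) (shift l k b))
      (show Near S 3 (transp (shift l k (0, 0)) (shift l k a) *
        transp (shift l k (0, 0)) (shift l k a)) 1 by
          simpa [Near] using transp_mul_self hne0a)
    rw [mul_one] at h4
    rw [← mul_assoc] at h4
    rw [transp_of_ne ha hb]
    exact (h1.congr_target (h3.trans h4)).mono (by ring_nf; omega)

end TranslationRules

/-! ### Trivial products of transpositions, eliminated point by point -/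

section Elimination

variable {F Y : Type*} [Group F] {R : Set F}

theorem FillsWithin.map_eq_one {G : Type*} [Group G] {f : F →* G} (hf : ∀ r ∈ R, f r = 1) {k : ℕ}
    {x : F} (h : FillsWithin R k x) : f x = 1 := by
  obtain ⟨L, -, h2, rfl⟩ := h
  rw [map_list_prod]
  refine List.prod_eq_one fun y hy => ?_
  simp only [List.map_map, List.mem_map, Function.comp_apply] at hy
  obtain ⟨c, hc, rfl⟩ := hy
  have : f c.2 = 1 := by
    rcases h2 c hc with h | h
    · exact hf _ h
    · simpa using hf _ h
  simp [this]

theorem Near.map_eq {G : Type*} [Group G] {f : F →* G} (hf : ∀ r ∈ R, f r = 1) {k : ℕ}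
    {x y : F} (h : Near R k x y) : f x = f y := by
  have := FillsWithin.map_eq_one hf h
  rwa [map_mul, map_inv, mul_inv_eq_one] at this

/-- The product of the values of `T` on a list of pairs. -/
def pairProd (T : Y → Y → F) (L : List (Y × Y)) : F := (L.map fun c => T c.1 c.2).prod

theorem pairProd_nil (T : Y → Y → F) : pairProd T [] = 1 := rfl

theorem pairProd_cons (T : Y → Y → F) (c : Y × Y) (L : List (Y × Y)) :
    pairProd T (c :: L) = T c.1 c.2 * pairProd T L := by
  simp [pairProd]

theorem pairProd_append (T : Y → Y → F) (L L' : List (Y × Y)) :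
    pairProd T (L ++ L') = pairProd T L * pairProd T L' := by
  simp [pairProd]

variable [DecidableEq Y]

/-- On the points of `P`, the elements `T a b` satisfy the relations between transpositions, up to
area `V`. -/
structure TranspCost (R : Set F) (T : Y → Y → F) (V : ℕ) (P : Finset Y) : Prop where
  mul_self : ∀ a ∈ P, ∀ b ∈ P, a ≠ b → FillsWithin R V (T a b * T a b)
  symm : ∀ a ∈ P, ∀ b ∈ P, a ≠ b → Near R V (T a b) (T b a)
  conj : ∀ a ∈ P, ∀ b ∈ P, ∀ c ∈ P, ∀ d ∈ P, a ≠ b → c ≠ d →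
    Cj R V (T c d) (T a b) (T (Equiv.swap c d a) (Equiv.swap c d b))

theorem TranspCost.subset {T : Y → Y → F} {V : ℕ} {P Q : Finset Y} (H : TranspCost R T V P)
    (h : Q ⊆ P) : TranspCost R T V Q where
  mul_self a ha b hb := H.mul_self a (h ha) b (h hb)
  symm a ha b hb := H.symm a (h ha) b (h hb)
  conj a ha b hb c hc d hd := H.conj a (h ha) b (h hb) c (h hc) d (h hd)

/-- Read from the right, the list keeps at most one factor moving `a`, at its front. A new factor
either passes through it, cancels it, or merges with it, each at cost at most `2 * V`, and the
number of factors never grows. -/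
theorem TranspCost.exists_isolate {T : Y → Y → F} {V : ℕ} {P : Finset Y}
    (H : TranspCost R T V P) {a : Y} (ha : a ∈ P) (L : List (Y × Y))
    (hL : ∀ c ∈ L, c.1 ≠ c.2 ∧ c.1 ∈ P ∧ c.2 ∈ P) :
    ∃ L' : List (Y × Y), (∀ c ∈ L', c.1 ≠ c.2 ∧ c.1 ∈ P.erase a ∧ c.2 ∈ P.erase a) ∧
      ((L'.length ≤ L.length ∧ Near R (2 * V * L.length) (pairProd T L) (pairProd T L')) ∨
      (L'.length + 1 ≤ L.length ∧ ∃ b ∈ P, b ≠ a ∧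
        Near R (2 * V * L.length) (pairProd T L) (T a b * pairProd T L'))) := by
  induction L with
  | nil => exact ⟨[], by simp, .inl ⟨le_rfl, by simpa using Near.refl _⟩⟩
  | cons c L ih =>
    obtain ⟨L', hL', h⟩ := ih fun c hc => hL c (by simp [hc])
    obtain ⟨c, d⟩ := c
    obtain ⟨hcd, hc, hd⟩ := hL (c, d) (by simp)
    simp only at hcd hc hd
    simp only [List.length_cons, pairProd_cons]
    by_cases hav : c ≠ a ∧ d ≠ a
    · have hL'' : ∀ e ∈ (c, d) :: L', e.1 ≠ e.2 ∧ e.1 ∈ P.erase a ∧ e.2 ∈ P.erase a := by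
        intro e he
        rcases List.mem_cons.1 he with rfl | he
        · exact ⟨hcd, by simp [hav, hc], by simp [hav, hd]⟩
        · exact hL' e he
      refine ⟨(c, d) :: L', hL'', ?_⟩
      rcases h with ⟨h1, h2⟩ | ⟨h1, b, hb, hba, h2⟩
      · refine .inl ⟨by simpa using h1, ?_⟩
        rw [pairProd_cons]
        exact (h2.mul_left _).mono (by rw [mul_add]; omega)
      · have hsa : Equiv.swap c d a = a :=
          Equiv.swap_apply_of_ne_of_ne hav.1.symm hav.2.symm
        refine .inr ⟨by simpa using h1, Equiv.swap c d b, ?_, ?_, ?_⟩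
        · rw [Equiv.swap_apply_def]
          split_ifs <;> assumption
        · intro h
          rw [← hsa] at h
          exact hba (by simpa using h)
        · rw [pairProd_cons]
          have h3 := H.conj a ha b hb c hc d hd hba.symm hcd
          rw [hsa] at h3
          have h4 := (h2.mul_left (T c d)).trans
            (by simpa [mul_assoc] using h3.near.mul_right (pairProd T L'))
          exact h4.mono (by rw [mul_add]; omega)
    · obtain ⟨e, he, hea, h3⟩ : ∃ e ∈ P, e ≠ a ∧ Near R V (T c d) (T a e) := by
        by_cases hca : c = a
        · subst hca
          exact ⟨d, hd, hcd.symm, (Near.refl _).mono (Nat.zero_le _)⟩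
        · have hda : d = a := by by_contra hda; exact hav ⟨hca, hda⟩
          subst hda
          exact ⟨c, hc, hca, H.symm c hc d hd hcd⟩
      rcases h with ⟨h1, h2⟩ | ⟨h1, b, hb, hba, h2⟩
      · refine ⟨L', hL', .inr ⟨by omega, e, he, hea, ?_⟩⟩
        exact (h3.mul h2).mono (by rw [mul_add]; omega)
      · by_cases hbe : b = e
        · subst hbe
          refine ⟨L', hL', .inl ⟨by omega, ?_⟩⟩
          have h4 : Near R V (T a b * T a b) 1 := by
            simpa [Near] using H.mul_self a ha b hb hba.symm
          have h5 := (h3.mul h2).trans (by simpa [mul_assoc] using h4.mul_right (pairProd T L'))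
          exact h5.mono (by rw [mul_add]; omega)
        -- This uses `T a e * T a b = T a b * T b e`, which leaves a single factor moving `a`.
        · refine ⟨(b, e) :: L', ?_, .inr ⟨by simpa using h1, b, hb, hba, ?_⟩⟩
          · intro f hf
            rcases List.mem_cons.1 hf with rfl | hf
            · exact ⟨hbe, by simp [hb, hba], by simp [he, hea]⟩
            · exact hL' f hf
          · have h4 := H.conj b hb e he a ha b hb hbe hba.symm
            rw [Equiv.swap_apply_right, Equiv.swap_apply_of_ne_of_ne hea (Ne.symm hbe)] at h4
            have h5 := (h3.mul h2).trans
              (by simpa [mul_assoc] using h4.near.symm.mul_right (pairProd T L'))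
            rw [pairProd_cons]
            exact h5.mono (by rw [mul_add]; omega)

/-- A product of `ℓ` transpositions of points of `P` that is trivial has area at most
`2 V ℓ |P|`. -/
theorem TranspCost.fillsWithin {T : Y → Y → F} {V : ℕ} {f : F →* Equiv.Perm Y}
    (hf : ∀ r ∈ R, f r = 1) (hT : ∀ a b, a ≠ b → f (T a b) = Equiv.swap a b) {P : Finset Y}
    (H : TranspCost R T V P) (L : List (Y × Y)) (hL : ∀ c ∈ L, c.1 ≠ c.2 ∧ c.1 ∈ P ∧ c.2 ∈ P)
    (h1 : f (pairProd T L) = 1) : FillsWithin R (2 * V * L.length * P.card) (pairProd T L) := by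
  induction hP : P.card generalizing P L with
  | zero =>
    rw [Finset.card_eq_zero] at hP
    subst hP
    cases L with
    | nil => simpa [pairProd_nil] using FillsWithin.one
    | cons c L => simpa using (hL c (by simp)).2
  | succ n ih =>
    obtain ⟨a, ha⟩ : P.Nonempty := Finset.card_pos.1 (by omega)
    obtain ⟨L', hL', ⟨h2, h3⟩ | ⟨h2, b, hb, hba, h3⟩⟩ := H.exists_isolate ha L hL
    · have h4 := ih (H.subset (Finset.erase_subset a P)) L' hL' ((h3.map_eq hf).symm.trans h1)
        (by rw [Finset.card_erase_of_mem ha, hP]; rfl)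
      have h5 : Near R (2 * V * L'.length * n) (pairProd T L') 1 := by simpa [Near] using h4
      refine (h3.trans h5).fillsWithin.mono ?_
      have : 2 * V * L'.length * n ≤ 2 * V * L.length * n := by gcongr
      rw [mul_add]
      omega
    -- The remaining factors fix `a`, so a leading `T a b` would make the whole product send `a` to
    -- `b`.
    · exfalso
      have hfix : ∀ K : List (Y × Y), (∀ c ∈ K, c.1 ≠ c.2 ∧ c.1 ∈ P.erase a ∧ c.2 ∈ P.erase a) →
          f (pairProd T K) a = a := by
        intro K hK
        induction K with
        | nil => simp [pairProd_nil]
        | cons c K ihK =>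
          obtain ⟨h4, h5, h6⟩ := hK c (by simp)
          rw [pairProd_cons, map_mul, Equiv.Perm.mul_apply, ihK fun c hc => hK c (by simp [hc]),
            hT _ _ h4, Equiv.swap_apply_of_ne_of_ne (Finset.ne_of_mem_erase h5).symm
              (Finset.ne_of_mem_erase h6).symm]
      have h4 := (h3.map_eq hf).symm.trans h1
      rw [map_mul, hT _ _ hba.symm] at h4
      have h5 := congrArg (fun σ : Equiv.Perm Y => σ a) h4
      simp only [Equiv.Perm.mul_apply, hfix L' hL', Equiv.swap_apply_left,
        Equiv.Perm.one_apply] at h5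
      exact hba h5

end Elimination

/-! ### Reduction of words to products of transpositions -/

section WordReduction

variable {m : ℕ}

local notation "S" => shortRelators m

theorem wordPerm_of_mem_shortRelators : ∀ r ∈ S, wordPerm m r = 1 := fun _ h => h.2

/-- At scale `N` the words `transp` behave like transpositions, up to area `V`. -/
structure RuleCost (m N V : ℕ) : Prop where
  one_le : 1 ≤ V
  transpCost : ∀ P : Finset (Fin (m + 3) × ℕ), (∀ y ∈ P, y.2 ≤ N) →
    TranspCost (shortRelators m) transp V P
  transl_conj : ∀ l k : Fin (m + 3), l ≠ k → ∀ a b : Fin (m + 3) × ℕ, a.2 + 1 ≤ N → b.2 + 1 ≤ N →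
    a ≠ b → Cj (shortRelators m) V (transl l k) (transp a b)
      (transp (shift l k a) (shift l k b))

/-- A list of pairs of distinct points at distance at most `r` from the origin. -/
def Within (r : ℕ) (L : List ((Fin (m + 3) × ℕ) × (Fin (m + 3) × ℕ))) : Prop :=
  ∀ c ∈ L, c.1 ≠ c.2 ∧ c.1.2 ≤ r ∧ c.2.2 ≤ r

theorem Within.nil (r : ℕ) : Within (m := m) r [] := by simp [Within]

theorem Within.mono {r s : ℕ} {L : List ((Fin (m + 3) × ℕ) × (Fin (m + 3) × ℕ))}
    (h : Within r L) (hrs : r ≤ s) : Within s L := fun c hc =>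
  ⟨(h c hc).1, (h c hc).2.1.trans hrs, (h c hc).2.2.trans hrs⟩

theorem Within.cons {r : ℕ} {L : List ((Fin (m + 3) × ℕ) × (Fin (m + 3) × ℕ))}
    {a b : Fin (m + 3) × ℕ} (hab : a ≠ b) (ha : a.2 ≤ r) (hb : b.2 ≤ r) (h : Within r L) :
    Within r ((a, b) :: L) := by
  intro c hc
  rcases List.mem_cons.1 hc with rfl | hc
  · exact ⟨hab, ha, hb⟩
  · exact h c hc

theorem Within.append {r : ℕ} {L L' : List ((Fin (m + 3) × ℕ) × (Fin (m + 3) × ℕ))}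
    (h : Within r L) (h' : Within r L') : Within r (L ++ L') := by
  intro c hc
  rcases List.mem_append.1 hc with hc | hc
  · exact h c hc
  · exact h' c hc

variable {N V : ℕ}

/-- Translations move past products of transpositions. -/
theorem RuleCost.transl_conj_pairProd (H : RuleCost m N V) {l k : Fin (m + 3)} (hlk : l ≠ k)
    {r : ℕ} (hr : r + 1 ≤ N) (L : List ((Fin (m + 3) × ℕ) × (Fin (m + 3) × ℕ)))
    (hL : Within r L) : ∃ L' : List ((Fin (m + 3) × ℕ) × (Fin (m + 3) × ℕ)),
      L'.length = L.length ∧ Within (r + 1) L' ∧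
      Cj S (V * L.length) (transl l k) (pairProd transp L) (pairProd transp L') := by
  induction L with
  | nil => exact ⟨[], rfl, Within.nil _, Cj.of_eq (by simp [pairProd_nil])⟩
  | cons c L ih =>
    obtain ⟨L', h1, h2, h3⟩ := ih fun c hc => hL c (by simp [hc])
    obtain ⟨a, b⟩ := c
    obtain ⟨hab, ha, hb⟩ := hL (a, b) (by simp)
    simp only at hab ha hb
    refine ⟨(shift l k a, shift l k b) :: L', by simp [h1], h2.cons (by simpa using hab)
      ((shift_snd_le l k a).trans (by omega)) ((shift_snd_le l k b).trans (by omega)), ?_⟩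
    rw [pairProd_cons, pairProd_cons]
    refine ((H.transl_conj l k hlk a b (by omega) (by omega) hab).mul h3).mono ?_
    rw [List.length_cons, mul_add]
    omega

/-- The words for the letters `(j, true)` and `(j, false)`: the translation from the ray `0` to
the ray `j + 1`, and its inverse. -/
def letter (s : Fin (m + 2) × Bool) : FreeGroup (HGen m) :=
  if s.2 then transl 0 s.1.succ else transl s.1.succ 0

theorem letter_not (j : Fin (m + 2)) (b : Bool) :
    letter (m := m) (j, !b) = (letter (j, b))⁻¹ := by
  cases b <;> simp [letter, transl]

theorem letter_eq (s : Fin (m + 2) × Bool) : ∃ l k : Fin (m + 3), l ≠ k ∧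
    letter (m := m) s = transl l k := by
  obtain ⟨j, b⟩ := s
  cases b
  · exact ⟨j.succ, 0, Fin.succ_ne_zero j, by simp [letter]⟩
  · exact ⟨0, j.succ, (Fin.succ_ne_zero j).symm, by simp [letter]⟩

theorem mk_cons_inl (j : Fin (m + 2)) (b : Bool) (w : List (HGen m × Bool)) :
    FreeGroup.mk ((.inl j, b) :: w) = letter (j, b) * FreeGroup.mk w := by
  have h : FreeGroup.mk ((.inl j, b) :: w) = FreeGroup.mk [(.inl j, b)] * FreeGroup.mk w := by
    rw [FreeGroup.mul_mk]; rfl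
  rw [h]
  congr 1
  cases b
  · have : (FreeGroup.of (Sum.inl j : HGen m))⁻¹ = FreeGroup.mk [(.inl j, false)] := by
      rw [FreeGroup.of, FreeGroup.inv_mk]; rfl
    simp [letter, transl, transGen, ← this]
  · simp [letter, transl, transGen, FreeGroup.of]

/-- Two permutations commute up to a transposition of points at distance at most `r`. -/
def SwapComm (r : ℕ) (s u : Equiv.Perm (Fin (m + 3) × ℕ)) : Prop :=
  ∃ a b, a ≠ b ∧ a.2 ≤ r ∧ b.2 ≤ r ∧ s * u = Equiv.swap a b * u * s

theorem SwapComm.symm {r : ℕ} {s u : Equiv.Perm (Fin (m + 3) × ℕ)} (h : SwapComm r s u) :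
    SwapComm r u s := by
  obtain ⟨a, b, hab, ha, hb, h⟩ := h
  refine ⟨a, b, hab, ha, hb, ?_⟩
  rw [mul_assoc _ s u, h, ← mul_assoc, ← mul_assoc, Equiv.swap_mul_self, one_mul]

theorem SwapComm.shift_inv {r : ℕ} {l k : Fin (m + 3)} {u : Equiv.Perm (Fin (m + 3) × ℕ)}
    (h : SwapComm r (shift l k) u) : SwapComm (r + 1) (shift k l) u := by
  obtain ⟨a, b, hab, ha, hb, h⟩ := h
  refine ⟨shift k l a, shift k l b, by simpa using hab, (shift_snd_le k l a).trans (by omega),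
    (shift_snd_le k l b).trans (by omega), ?_⟩
  rw [← mul_swap_mul_inv, ← _root_.shift_inv l k]
  have h2 : u = (shift l k)⁻¹ * (Equiv.swap a b * u * shift l k) := by rw [← h]; group
  have h3 : (Equiv.swap a b)⁻¹ = Equiv.swap a b := Equiv.swap_inv a b
  calc (shift l k)⁻¹ * u
      = (shift l k)⁻¹ * ((Equiv.swap a b)⁻¹ * (shift l k * u) * (shift l k)⁻¹) := by
        rw [h]; group
    _ = _ := by rw [h3]; group

theorem swapComm_shift_shift {j k : Fin (m + 3)} (hj : j ≠ 0) (hk : k ≠ 0) (hjk : j ≠ k) :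
    SwapComm 0 (shift 0 k) (shift 0 j) := by
  refine ⟨(k, 0), (j, 0), by simp [hjk.symm], le_rfl, le_rfl, ?_⟩
  have h1 := shift_mul_shift_of_ne hk.symm hj.symm hjk.symm
  have h2 := mul_swap_mul_inv (shift 0 j) (k, 0) (0, 0)
  rw [shift_apply_zero _ _ hj.symm, shift_apply_of_ne _ _ _ hk hjk.symm] at h2
  rw [← h2, ← shift_mul_shift j k 0, ← mul_assoc, h1, shift_mul_shift]
  group

/-- For two forward letters the correcting transposition has height 0; inverting a letter conjugates
it by a shift and raises it by at most one, hence the 2. -/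
theorem swapComm_letter {s u : Fin (m + 2) × Bool} (h : s.1 ≠ u.1) :
    SwapComm 2 (wordPerm m (letter s)) (wordPerm m (letter u)) := by
  obtain ⟨j, b⟩ := s
  obtain ⟨k, c⟩ := u
  have h0 := swapComm_shift_shift (Fin.succ_ne_zero k) (Fin.succ_ne_zero j)
    (fun h' => h (Fin.succ_injective _ h').symm)
  have weaken : ∀ {r : ℕ} {s u : Equiv.Perm (Fin (m + 3) × ℕ)}, r ≤ 2 → SwapComm r s u →
      SwapComm 2 s u := by
    rintro r s u hr ⟨a, b, hab, ha, hb, h⟩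
    exact ⟨a, b, hab, ha.trans hr, hb.trans hr, h⟩
  cases b <;> cases c <;> simp only [letter, if_true, Bool.false_eq_true, if_false,
    wordPerm_transl]
  · exact h0.shift_inv.symm.shift_inv.symm
  · exact weaken (by omega) h0.shift_inv
  · exact weaken (by omega) h0.symm.shift_inv.symm
  · exact weaken (by omega) h0

theorem short_letter (s : Fin (m + 2) × Bool) : Short 2 (letter (m := m) s) := by
  obtain ⟨l, k, -, h⟩ := letter_eq (m := m) s
  rw [h]
  exact short_transl l k

theorem letter_mul_letter (s u : Fin (m + 2) × Bool) :
    ∃ L : List ((Fin (m + 3) × ℕ) × (Fin (m + 3) × ℕ)), L.length ≤ 1 ∧ Within 2 L ∧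
      Near S 1 (letter s * letter u) (pairProd transp L * letter u * letter s) := by
  by_cases h : s.1 = u.1
  · refine ⟨[], by simp, Within.nil _, ?_⟩
    obtain ⟨j, b⟩ := s
    obtain ⟨k, c⟩ := u
    simp only at h
    subst h
    refine (Near.of_eq ?_).mono (Nat.zero_le _)
    cases b <;> cases c <;> simp [pairProd_nil, letter, transl]
  · obtain ⟨a, b, hab, ha, hb, hc⟩ := swapComm_letter h
    refine ⟨[(a, b)], by simp, (Within.nil _).cons hab ha hb, ?_⟩
    rw [pairProd_cons, pairProd_nil, mul_one]
    refine near_of_short ((short_letter s).mul (short_letter u))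
      (((short_transp (a := a) (b := b) (by omega) (by omega)).mul (short_letter u)).mul (short_letter s))
      (by omega) ?_
    rw [map_mul, hc, map_mul, map_mul, wordPerm_transp hab]

/-- The product of a list of letters. -/
def letterProd (v : List (Fin (m + 2) × Bool)) : FreeGroup (HGen m) := (v.map letter).prod

theorem letterProd_cons (s : Fin (m + 2) × Bool) (v : List (Fin (m + 2) × Bool)) :
    letterProd (m := m) (s :: v) = letter s * letterProd v := by
  simp [letterProd]

theorem letterProd_append (v v' : List (Fin (m + 2) × Bool)) :
    letterProd (m := m) (v ++ v') = letterProd v * letterProd v' := by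
  simp [letterProd]

/-- A letter moves past a word at the cost of transpositions. -/
theorem RuleCost.letter_mul_letterProd (H : RuleCost m N V) (s : Fin (m + 2) × Bool)
    (v : List (Fin (m + 2) × Bool)) (hv : v.length + 1 ≤ N) :
    ∃ L : List ((Fin (m + 3) × ℕ) × (Fin (m + 3) × ℕ)), L.length ≤ v.length ∧
      Within (v.length + 1) L ∧
      Near S (V * (v.length * v.length)) (letter s * letterProd v)
        (pairProd transp L * letterProd v * letter s) := by
  induction v with
  | nil =>
    exact ⟨[], by simp, Within.nil _, (Near.of_eq (by simp [pairProd_nil, letterProd])).mono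
      (Nat.zero_le _)⟩
  | cons u v ih =>
    rw [List.length_cons] at hv
    obtain ⟨L, h1, h2, h3⟩ := ih (by omega)
    obtain ⟨L₁, h4, h5, h6⟩ := letter_mul_letter (m := m) s u
    obtain ⟨l, k, hlk, hu⟩ := letter_eq (m := m) u
    obtain ⟨L', h7, h8, h9⟩ := H.transl_conj_pairProd hlk hv L h2
    refine ⟨L₁ ++ L', by simp; omega, (h5.mono (by simp)).append (by simpa using h8), ?_⟩
    rw [letterProd_cons, pairProd_append]
    rw [← hu] at h9
    have e1 := h6.mul_right (letterProd v)
    have e2 := h3.mul_left (pairProd transp L₁ * letter u)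
    have e3 := (h9.near.mul_left (pairProd transp L₁)).mul_right (letterProd v * letter s)
    simp only [mul_assoc] at e1 e2 e3 ⊢
    refine ((e1.trans e2).trans e3).mono ?_
    have := H.one_le
    have h10 : V * L.length ≤ V * v.length := Nat.mul_le_mul_left _ h1
    rw [List.length_cons]
    nlinarith

theorem count_cancel {α : Type*} [DecidableEq α] {x : α} {b : Bool} {p q : List (α × Bool)}
    (h : ∀ y, List.count (y, true) ((x, b) :: (p ++ (x, !b) :: q)) =
      List.count (y, false) ((x, b) :: (p ++ (x, !b) :: q))) (y : α) :
    List.count (y, true) (p ++ q) = List.count (y, false) (p ++ q) := by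
  have := h y
  simp only [List.count_cons, List.count_append] at this ⊢
  by_cases hxy : x = y
  · subst hxy
    cases b <;> simp at this <;> omega
  · simpa [hxy] using this

/-- A word in the translations that has exponent sum zero in each of them is a product of
transpositions. -/
theorem RuleCost.letterProd_near (H : RuleCost m N V) (ℓ : ℕ) : ∀ v : List (Fin (m + 2) × Bool),
    v.length ≤ ℓ → ℓ + 1 ≤ N → (∀ j, v.count (j, true) = v.count (j, false)) →
    ∃ L : List ((Fin (m + 3) × ℕ) × (Fin (m + 3) × ℕ)), L.length ≤ ℓ * ℓ ∧
      Within (ℓ + 1) L ∧ Near S (V * (ℓ * ℓ * ℓ)) (letterProd v) (pairProd transp L) := by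
  induction ℓ with
  | zero =>
    intro v hv _ _
    rw [Nat.le_zero, List.length_eq_zero_iff] at hv
    subst hv
    exact ⟨[], by simp, Within.nil _, (Near.refl _).mono (Nat.zero_le _)⟩
  | succ ℓ ih =>
    intro v hv hN hcount
    cases v with
    | nil => exact ⟨[], by simp, Within.nil _, (Near.refl _).mono (Nat.zero_le _)⟩
    | cons s v =>
      obtain ⟨j, b⟩ := s
      -- Equal counts force the inverse of the first letter to occur later. Carrying the first
      -- letter there cancels the pair and releases at most one transposition per letter passed.
      have hmem : (j, !b) ∈ v := by
        have h1 := hcount j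
        have : 0 < v.count (j, !b) := by
          cases b <;> simp at h1 <;>
            simp only [Bool.not_true, Bool.not_false] <;> omega
        exact List.count_pos_iff.1 this
      obtain ⟨p, q, rfl⟩ := List.append_of_mem hmem
      simp only [List.length_cons, List.length_append] at hv
      obtain ⟨L, h1, h2, h3⟩ := ih (p ++ q) (by simp; omega) (by omega) (count_cancel hcount)
      obtain ⟨L₁, h4, h5, h6⟩ := H.letter_mul_letterProd (j, b) p (by omega)
      refine ⟨L₁ ++ L, ?_, (h5.mono (by omega)).append (h2.mono (by omega)), ?_⟩
      · rw [List.length_append]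
        nlinarith
      · have e1 := h6.mul_right (letter (j, !b) * letterProd q)
        have e2 := h3.mul_left (pairProd transp L₁)
        rw [letterProd_cons, letterProd_append, letterProd_cons, pairProd_append]
        rw [letterProd_append] at e2
        simp only [letter_not, mul_assoc, mul_inv_cancel_left] at e1 e2 ⊢
        refine (e1.trans e2).mono ?_
        have h7 : p.length * p.length ≤ ℓ * ℓ := Nat.mul_le_mul (by omega) (by omega)
        rw [← mul_add]
        refine Nat.mul_le_mul_left _ ?_
        nlinarith

theorem mk_singleton_inr (z : Fin (m + 3) × Fin (m + 3)) (b : Bool) :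
    ∃ a c : Fin (m + 3) × ℕ, a ≠ c ∧ a.2 ≤ 1 ∧ c.2 ≤ 1 ∧
      Near S 1 (FreeGroup.mk [(.inr z, b)]) (transp a c) := by
  obtain ⟨i, j⟩ := z
  obtain ⟨a, c, hac, ha, hc, h⟩ : ∃ a c : Fin (m + 3) × ℕ, a ≠ c ∧ a.2 ≤ 1 ∧ c.2 ≤ 1 ∧
      genPerm (.inr (i, j)) = Equiv.swap a c := by
    by_cases hij : i = j
    · exact ⟨(i, 0), (i, 1), by simp, by simp, by simp, by simp [genPerm, hij]⟩
    · exact ⟨(i, 0), (j, 0), by simp [hij], by simp, by simp, by simp [genPerm, hij]⟩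
  refine ⟨a, c, hac, ha, hc, near_of_short (k := 1) ?_ (short_transp (by omega) (by omega))
    (by omega) ?_⟩
  · exact FreeGroup.norm_mk_le
  · rw [wordPerm_transp hac, wordPerm, FreeGroup.lift_mk]
    cases b <;> simp [h]

/-- Every word is a product of transpositions times a word in the translations. -/
theorem RuleCost.mk_near (H : RuleCost m N V) (w : List (HGen m × Bool)) (hw : w.length + 1 ≤ N) :
    ∃ (L : List ((Fin (m + 3) × ℕ) × (Fin (m + 3) × ℕ))) (v : List (Fin (m + 2) × Bool)),
      L.length ≤ w.length ∧ Within (w.length + 1) L ∧ v.length ≤ w.length ∧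
      Near S (V * (w.length * w.length)) (FreeGroup.mk w) (pairProd transp L * letterProd v) := by
  induction w with
  | nil =>
    exact ⟨[], [], by simp, Within.nil _, by simp, (Near.of_eq (by
      simp [pairProd_nil, letterProd, FreeGroup.one_eq_mk])).mono (Nat.zero_le _)⟩
  | cons s w ih =>
    rw [List.length_cons] at hw ⊢
    obtain ⟨L, v, h1, h2, h3, h4⟩ := ih (by omega)
    have hV := H.one_le
    obtain ⟨s | z, b⟩ := s
    · obtain ⟨l, k, hlk, hu⟩ := letter_eq (m := m) (s, b)
      obtain ⟨L', h7, h8, h9⟩ := H.transl_conj_pairProd hlk hw L h2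
      rw [← hu] at h9
      refine ⟨L', (s, b) :: v, by omega, h8, by simpa using h3, ?_⟩
      rw [mk_cons_inl, letterProd_cons]
      have e1 := h4.mul_left (letter (s, b))
      have e2 := h9.near.mul_right (letterProd v)
      simp only [mul_assoc] at e1 e2 ⊢
      refine (e1.trans e2).mono ?_
      have h10 : V * L.length ≤ V * w.length := Nat.mul_le_mul_left _ h1
      nlinarith
    · obtain ⟨a, c, hac, ha, hc, h5⟩ := mk_singleton_inr (m := m) z b
      refine ⟨(a, c) :: L, v, by simpa using h1, (h2.mono (by omega)).cons hac (by omega)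
        (by omega), by omega, ?_⟩
      have e : FreeGroup.mk ((Sum.inr z, b) :: w) =
          FreeGroup.mk [(Sum.inr z, b)] * FreeGroup.mk w := by
        rw [FreeGroup.mul_mk]; rfl
      rw [e, pairProd_cons, mul_assoc]
      refine (h5.mul h4).mono ?_
      nlinarith

end WordReduction

/-! ### Displacement along rays and generation of the group -/

section EventualTranslations

variable {m : ℕ}

local notation "S" => shortRelators m

/-- `g` is eventually the translation by `d` on the ray `k`. -/
def RayShift {n : ℕ} (g : Equiv.Perm (Fin n × ℕ)) (k : Fin n) (d : ℤ) : Prop :=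
  ∃ K : ℕ, ∀ p, K ≤ p → (g (k, p)).1 = k ∧ ((g (k, p)).2 : ℤ) = p + d

variable {n : ℕ} {g h : Equiv.Perm (Fin n × ℕ)} {k : Fin n} {d d' : ℤ}

theorem RayShift.one : RayShift (1 : Equiv.Perm (Fin n × ℕ)) k 0 := ⟨0, by simp⟩

theorem RayShift.mul (hg : RayShift g k d) (hh : RayShift h k d') :
    RayShift (g * h) k (d + d') := by
  obtain ⟨K, hK⟩ := hg
  obtain ⟨K', hK'⟩ := hh
  refine ⟨K' + K + d'.natAbs, fun p hp => ?_⟩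
  obtain ⟨h1, h2⟩ := hK' p (by omega)
  have h3 : h (k, p) = (k, (h (k, p)).2) := Prod.ext h1 rfl
  obtain ⟨h4, h5⟩ := hK (h (k, p)).2 (by omega)
  rw [Equiv.Perm.mul_apply, h3]
  exact ⟨h4, by omega⟩

theorem RayShift.inv (hg : RayShift g k d) : RayShift g⁻¹ k (-d) := by
  obtain ⟨K, hK⟩ := hg
  refine ⟨K + d.natAbs, fun p hp => ?_⟩
  obtain ⟨q, hq⟩ : ∃ q : ℕ, (q : ℤ) = p - d := ⟨(p - d).toNat, by omega⟩
  obtain ⟨h1, h2⟩ := hK q (by omega)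
  have h3 : g (k, q) = (k, p) := Prod.ext h1 (by simp only; omega)
  have h4 : g⁻¹ (k, p) = (k, q) := by rw [← h3]; simp
  rw [h4]
  exact ⟨rfl, by simp only; omega⟩

theorem RayShift.pow (hg : RayShift g k d) (e : ℕ) : RayShift (g ^ e) k (e * d) := by
  induction e with
  | zero => simpa using RayShift.one
  | succ e ih =>
    rw [pow_succ]
    convert ih.mul hg using 1
    push_cast
    ring

theorem RayShift.zpow (hg : RayShift g k d) (e : ℤ) : RayShift (g ^ e) k (e * d) := by
  cases e with
  | ofNat e => simpa using hg.pow e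
  | negSucc e =>
    rw [zpow_negSucc]
    convert (hg.pow (e + 1)).inv using 1
    rw [Int.negSucc_eq]
    push_cast
    ring

theorem RayShift.unique (hg : RayShift g k d) (hg' : RayShift g k d') : d = d' := by
  obtain ⟨K, hK⟩ := hg
  obtain ⟨K', hK'⟩ := hg'
  have h1 := (hK (K + K') (by omega)).2
  have h2 := (hK' (K + K') (by omega)).2
  omega

theorem rayShift_swap (a b : Fin n × ℕ) (k : Fin n) : RayShift (Equiv.swap a b) k 0 := by
  refine ⟨a.2 + b.2 + 1, fun p hp => ?_⟩
  rw [Equiv.swap_apply_of_ne_of_ne]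
  · simp
  · rintro rfl
    simp only at hp
    omega
  · rintro rfl
    simp only at hp
    omega

theorem rayShift_shift {l k : Fin n} (hlk : l ≠ k) (i : Fin n) :
    RayShift (shift l k) i (if i = k then 1 else if i = l then -1 else 0) := by
  refine ⟨1, fun p hp => ?_⟩
  obtain ⟨p, rfl⟩ : ∃ q, p = q + 1 := ⟨p - 1, by omega⟩
  by_cases hk : i = k
  · subst hk
    rw [shift_apply_target _ _ hlk]
    simp
  by_cases hl : i = l
  · subst hl
    rw [shift_apply_succ _ _ hlk]
    simp [hk]
  · rw [shift_apply_of_ne _ _ _ hl hk]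
    simp [hk, hl]

theorem mem_houghtonGroup_iff : g ∈ houghtonGroup n ↔ ∀ k, ∃ d, RayShift g k d := by
  constructor
  · rintro ⟨d, K, h⟩ k
    refine ⟨d k, K.sup Prod.snd + 1, fun p hp => h k p fun hmem => ?_⟩
    have : p ≤ K.sup Prod.snd := Finset.le_sup (f := Prod.snd) hmem
    omega
  · intro H
    choose d K h using H
    refine ⟨d, Finset.univ.biUnion fun k => (Finset.range (K k)).image (Prod.mk k),
      fun k p hp => h k p ?_⟩
    by_contra hlt
    exact hp (by simpa using hlt)

/-- The points `(k, p)` with `p < a k`. -/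
def initialSegments (a : Fin n → ℕ) : Finset (Fin n × ℕ) :=
  (Finset.univ.sigma fun k => Finset.range (a k)).map (Equiv.sigmaEquivProd _ _).toEmbedding

theorem mem_initialSegments {a : Fin n → ℕ} {y : Fin n × ℕ} :
    y ∈ initialSegments a ↔ y.2 < a y.1 := by
  simp [initialSegments]

theorem card_initialSegments (a : Fin n → ℕ) : (initialSegments a).card = ∑ k, a k := by
  simp [initialSegments]

/-- For large `M` the bijection carries the points of height below `M` onto initial segments of
lengths `M + d k`; compare cardinalities. -/
theorem RayShift.sum_eq_zero {d : Fin n → ℤ} (H : ∀ k, RayShift g k (d k)) : ∑ k, d k = 0 := by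
  choose K hK using H
  set M : ℕ := ∑ k, (K k + (d k).natAbs) with hM
  have hKM : ∀ k, K k + (d k).natAbs ≤ M := fun k =>
    Finset.single_le_sum (f := fun k => K k + (d k).natAbs) (fun _ _ => Nat.zero_le _)
      (Finset.mem_univ k)
  set a : Fin n → ℕ := fun k => (M + d k).toNat with ha
  have ha' : ∀ k, (a k : ℤ) = M + d k := fun k => by
    have := hKM k
    simp only [ha]
    omega
  have h1 : (initialSegments fun _ : Fin n => M).map g.toEmbedding = initialSegments a := by
    ext y
    rw [Finset.mem_map_equiv, mem_initialSegments, mem_initialSegments]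
    constructor
    · intro hy
      by_contra hlt
      obtain ⟨k, q⟩ := y
      have h2 := ha' k
      have h3 := hKM k
      simp only at hlt hy
      obtain ⟨p, hp⟩ : ∃ p : ℕ, (p : ℤ) = q - d k := ⟨(q - d k).toNat, by omega⟩
      obtain ⟨h4, h5⟩ := hK k p (by omega)
      have h6 : g (k, p) = (k, q) := Prod.ext h4 (by simp only; omega)
      rw [← h6, Equiv.symm_apply_apply] at hy
      simp only at hy
      omega
    · intro hy
      by_contra hlt
      obtain ⟨⟨k, p⟩, rfl⟩ := g.surjective y
      rw [Equiv.symm_apply_apply] at hlt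
      simp only at hlt
      have h2 := ha' k
      have h3 := hKM k
      obtain ⟨h4, h5⟩ := hK k p (by omega)
      rw [h4] at hy
      omega
  have h2 := congrArg Finset.card h1
  rw [Finset.card_map, card_initialSegments, card_initialSegments] at h2
  have h3 : (∑ _k : Fin n, (M : ℤ)) = ∑ k, (M + d k) := by
    have := congrArg (Nat.cast : ℕ → ℤ) h2
    push_cast at this
    rw [this]
    exact Finset.sum_congr rfl fun k _ => ha' k
  rw [Finset.sum_add_distrib] at h3
  omega

theorem genPerm_mem (s : HGen m) : genPerm s ∈ houghtonGroup (m + 3) := by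
  rw [mem_houghtonGroup_iff]
  intro k
  obtain j | ⟨i, j⟩ := s
  · exact ⟨_, rayShift_shift (Fin.succ_ne_zero j).symm k⟩
  · rw [genPerm]
    split_ifs
    · exact ⟨0, rayShift_swap _ _ k⟩
    · exact ⟨0, rayShift_swap _ _ k⟩

theorem mem_range_of_finite_support {f : Equiv.Perm (Fin (m + 3) × ℕ)}
    (H : ∀ k, RayShift f k 0) : f ∈ (wordPerm m).range := by
  have hsub : Subgroup.closure {σ : Equiv.Perm (Fin (m + 3) × ℕ) | σ.IsSwap} ≤
      (wordPerm m).range := by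
    rw [Subgroup.closure_le]
    rintro σ ⟨a, b, hab, rfl⟩
    exact ⟨transp a b, wordPerm_transp hab⟩
  refine hsub (mem_closure_isSwap'.2 ?_)
  choose K hK using H
  refine (initialSegments K).finite_toSet.subset fun y hy => ?_
  rw [Finset.mem_coe, mem_initialSegments]
  by_contra hlt
  apply hy
  obtain ⟨h1, h2⟩ := hK y.1 y.2 (by omega)
  exact Prod.ext h1 (by simpa using h2)

/-- Powers of the generating translations remove the displacement ray by ray. On ray `0` it then
vanishes because displacements sum to zero, and a permutation of finite support remains. -/
theorem mem_range_of_rayShift (s : Finset (Fin (m + 2))) : ∀ f ∈ houghtonGroup (m + 3),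
    (∀ j ∉ s, RayShift f j.succ 0) → f ∈ (wordPerm m).range := by
  induction s using Finset.induction_on with
  | empty =>
    intro f hf H
    obtain ⟨d, hd⟩ := mem_houghtonGroup_iff.1 hf 0
    have h1 : ∀ k, RayShift f k (if k = 0 then d else 0) := by
      intro k
      cases k using Fin.cases with
      | zero => simpa using hd
      | succ j => simpa [Fin.succ_ne_zero] using H j (by simp)
    have h2 := RayShift.sum_eq_zero h1
    simp only [Finset.sum_ite_eq', Finset.mem_univ, if_true] at h2
    subst h2
    exact mem_range_of_finite_support fun k => by simpa using h1 k
  | insert j s hj ih =>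
    intro f hf H
    obtain ⟨d, hd⟩ := mem_houghtonGroup_iff.1 hf j.succ
    have hj0 := (Fin.succ_ne_zero j).symm
    have h1 : wordPerm m (transGen j.succ ^ (-d)) = shift 0 j.succ ^ (-d) := by
      rw [map_zpow, wordPerm_transGen]
    have h2 : f * shift 0 j.succ ^ (-d) ∈ (wordPerm m).range := by
      refine ih _ (mul_mem hf (zpow_mem (genPerm_mem (.inl j)) _)) fun i hi => ?_
      by_cases hij : i = j
      · subst hij
        convert hd.mul ((rayShift_shift hj0 i.succ).zpow (-d)) using 1
        simp
      · convert (H i (by simp [hij, hi])).mul ((rayShift_shift hj0 i.succ).zpow (-d)) using 1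
        simp [Fin.succ_ne_zero, hij]
    rw [← h1] at h2
    have h3 := mul_mem h2 (inv_mem (⟨_, rfl⟩ : wordPerm m (transGen j.succ ^ (-d)) ∈
      (wordPerm m).range))
    rwa [mul_inv_cancel_right] at h3

theorem range_wordPerm : (wordPerm m).range = houghtonGroup (m + 3) := by
  refine le_antisymm ?_ fun f hf => mem_range_of_rayShift Finset.univ f hf (by simp)
  refine FreeGroup.range_lift_le ?_
  rintro _ ⟨s, rfl⟩
  exact genPerm_mem s

theorem rayShift_letterProd (v : List (Fin (m + 2) × Bool)) (j : Fin (m + 2)) :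
    RayShift (wordPerm m (letterProd v)) j.succ (v.count (j, true) - v.count (j, false)) := by
  induction v with
  | nil => simpa [letterProd] using RayShift.one
  | cons s v ih =>
    obtain ⟨i, b⟩ := s
    rw [letterProd_cons, map_mul]
    have h1 : RayShift (wordPerm m (letter (i, b))) j.succ
        (if i = j then (if b then 1 else -1) else 0) := by
      cases b
      · simp only [letter, Bool.false_eq_true, if_false, wordPerm_transl]
        convert rayShift_shift (Fin.succ_ne_zero i) j.succ using 1
        simp [Fin.succ_ne_zero, eq_comm]
      · simp only [letter, if_true, wordPerm_transl]
        convert rayShift_shift (Fin.succ_ne_zero i).symm j.succ using 1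
        simp [Fin.succ_ne_zero, eq_comm]
    convert h1.mul ih using 1
    by_cases hij : i = j
    · subst hij
      cases b <;> simp <;> ring
    · simp [hij]

theorem rayShift_pairProd {L : List ((Fin (m + 3) × ℕ) × (Fin (m + 3) × ℕ))}
    (hL : ∀ c ∈ L, c.1 ≠ c.2) (k : Fin (m + 3)) :
    RayShift (wordPerm m (pairProd transp L)) k 0 := by
  induction L with
  | nil => simpa [pairProd_nil] using RayShift.one
  | cons c L ih =>
    rw [pairProd_cons, map_mul, wordPerm_transp (hL c (by simp))]
    simpa using (rayShift_swap c.1 c.2 k).mul (ih fun c hc => hL c (by simp [hc]))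

end EventualTranslations

/-! ### Area of a trivial word -/

section AreaBound

variable {m : ℕ}

local notation "S" => shortRelators m

theorem exists_ruleCost (m N : ℕ) : RuleCost m N
    (90 * N * ((2 * N + 3) * ((6 * N + 7) * (5 * 9 ^ N))) + 20) := by
  set U := 5 * 9 ^ N with hU
  set Z := (2 * N + 3) * ((6 * N + 7) * U) with hZ
  have H : LevelCost N U := ⟨le_rfl⟩
  have hUZ : U ≤ Z := by
    rw [hZ, ← mul_assoc]
    exact Nat.le_mul_of_pos_left _ (by positivity)
  have HZ : AdjCost m N Z := ⟨by have := H.pos; omega,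
    fun i p y hp hy2 hi hy => adj_conj_starAt H hp hy2 hi hy⟩
  have h72 : 72 * N * Z ≤ 90 * N * Z := by gcongr; omega
  have h24 : 24 * N * Z ≤ 90 * N * Z := by gcongr; omega
  refine ⟨by omega, fun P hP => ⟨fun a _ b _ hab => (transp_mul_self hab).mono (by omega),
    fun a ha b hb hab => (transp_near_symm HZ (hP a ha) (hP b hb) hab).mono (by omega),
    fun a ha b hb c hc d hd hab hcd => (transp_conj_transp HZ (hP a ha) (hP b hb) (hP c hc)
      (hP d hd) hab hcd).mono (by omega)⟩,
    fun l k hlk a b ha hb hab => transl_conj_transp H HZ hUZ hlk ha hb hab⟩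

/-- The area of a trivial word in terms of the cost of the rules at the scale of its length. -/
theorem RuleCost.fillsWithin {V : ℕ} (w : List (HGen m × Bool))
    (H : RuleCost m (w.length + 1) V) (hw : wordPerm m (FreeGroup.mk w) = 1) :
    FillsWithin S (V * (w.length * w.length) + V * (w.length * w.length * w.length) +
      2 * V * (w.length + w.length * w.length) * ((m + 3) * (w.length + 2)))
      (FreeGroup.mk w) := by
  obtain ⟨L, v, h1, h2, h3, h4⟩ := H.mk_near w le_rfl
  have h5 := h4.map_eq wordPerm_of_mem_shortRelators
  rw [hw, map_mul] at h5
  -- Transpositions displace no ray eventually, so on ray `j.succ` the displacement is the exponent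
  -- sum of letter `j`, which triviality makes zero.
  have hcount : ∀ j, v.count (j, true) = v.count (j, false) := by
    intro j
    have h6 := (rayShift_pairProd (fun c hc => (h2 c hc).1) j.succ).mul (rayShift_letterProd v j)
    rw [← h5] at h6
    have := h6.unique RayShift.one
    omega
  obtain ⟨L', h6, h7, h8⟩ := H.letterProd_near w.length v h3 le_rfl hcount
  have h9 : Near S (V * (w.length * w.length) + V * (w.length * w.length * w.length))
      (FreeGroup.mk w) (pairProd transp (L ++ L')) := by
    rw [pairProd_append]
    exact h4.trans (h8.mul_left _)
  have h10 : wordPerm m (pairProd transp (L ++ L')) = 1 := by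
    rw [← h9.map_eq wordPerm_of_mem_shortRelators, hw]
  set P : Finset (Fin (m + 3) × ℕ) := Finset.univ ×ˢ Finset.range (w.length + 2) with hP
  have hmem : ∀ y : Fin (m + 3) × ℕ, y ∈ P ↔ y.2 ≤ w.length + 1 := fun y => by
    simp [hP, Finset.mem_product]
    omega
  have h11 := (H.transpCost P fun y hy => (hmem y).1 hy).fillsWithin
    wordPerm_of_mem_shortRelators (fun a b hab => wordPerm_transp hab) (L ++ L')
    (fun c hc => by
      obtain ⟨e1, e2, e3⟩ := h2.append h7 c hc
      exact ⟨e1, (hmem _).2 e2, (hmem _).2 e3⟩) h10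
  have h12 : Near S (2 * V * (L ++ L').length * P.card) (pairProd transp (L ++ L')) 1 := by
    simpa [Near] using h11
  refine (h9.trans h12).fillsWithin.mono ?_
  have h13 : P.card = (m + 3) * (w.length + 2) := by simp [hP]
  rw [h13, List.length_append]
  gcongr

end AreaBound

/-! ### Change of presentation and growth comparison -/

section Transfer

theorem FillsWithin.wordArea_le {A : Type*} {R : Set (FreeGroup A)} {w : List (A × Bool)} {k : ℕ}
    (h : FillsWithin R k (FreeGroup.mk w)) : wordArea R w ≤ k := by
  obtain ⟨L, h1, h2, h3⟩ := h
  have h4 : HasFilling R w L.length := ⟨L, rfl, h2, h3⟩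
  exact (Nat.sInf_le h4).trans h1

theorem exists_fillsWithin {A : Type*} {R : Set (FreeGroup A)} {g : FreeGroup A}
    (h : g ∈ Subgroup.normalClosure R) : ∃ k, FillsWithin R k g := by
  classical
  have h1 : IsNullHomotopic R g.toWord := by rwa [IsNullHomotopic, FreeGroup.mk_toWord]
  obtain ⟨k, L, h2, h3, h4⟩ := (isNullHomotopic_iff_exists_hasFilling R _).1 h1
  exact ⟨k, L, h2.le, h3, by rwa [FreeGroup.mk_toWord] at h4⟩

theorem exists_fillsWithin_of_finite {A : Type*} {R T : Set (FreeGroup A)} (hT : T.Finite)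
    (h : ∀ g ∈ T, g ∈ Subgroup.normalClosure R) : ∃ K, ∀ g ∈ T, FillsWithin R K g := by
  choose! k hk using fun g hg => exists_fillsWithin (h g hg)
  obtain ⟨K, hK⟩ := (hT.image k).bddAbove
  exact ⟨K, fun g hg => (hk g hg).mono (hK ⟨g, hg, rfl⟩)⟩

theorem FreeGroup.mk_cons {A : Type*} (a : A) (b : Bool) (w : List (A × Bool)) :
    FreeGroup.mk ((a, b) :: w) =
      (if b then FreeGroup.of a else (FreeGroup.of a)⁻¹) * FreeGroup.mk w := by
  cases b <;> simp [FreeGroup.of, FreeGroup.inv_mk, FreeGroup.mul_mk, FreeGroup.invRev]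

/-- An endomorphism of the free group that moves each generator by an element of area at most `K`
moves each word by an element of area at most `K` times its length. -/
theorem near_endomorphism {A : Type*} {R : Set (FreeGroup A)} (f : FreeGroup A →* FreeGroup A)
    {K : ℕ} (hf : ∀ a, Near R K (FreeGroup.of a) (f (FreeGroup.of a))) (w : List (A × Bool)) :
    Near R (K * w.length) (FreeGroup.mk w) (f (FreeGroup.mk w)) := by
  induction w with
  | nil =>
    rw [← FreeGroup.one_eq_mk, map_one]
    exact (Near.refl 1).mono (Nat.zero_le _)
  | cons s w ih =>
    obtain ⟨a, b⟩ := s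
    rw [FreeGroup.mk_cons, map_mul, List.length_cons]
    refine Near.mono (Near.mul ?_ ih) (show K + K * w.length ≤ _ by rw [mul_add]; omega)
    cases b
    · simpa using (hf a).inv
    · simpa using hf a

theorem FreeGroup.norm_lift_mk_le {A B : Type*} [DecidableEq B] (f : A → FreeGroup B) {ℓ : ℕ}
    (hf : ∀ a, (f a).norm ≤ ℓ) (w : List (A × Bool)) :
    (FreeGroup.lift f (FreeGroup.mk w)).norm ≤ ℓ * w.length := by
  induction w with
  | nil => simp [← FreeGroup.one_eq_mk]
  | cons s w ih =>
    obtain ⟨a, b⟩ := s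
    rw [FreeGroup.mk_cons, _root_.map_mul, List.length_cons, mul_add, add_comm]
    refine (FreeGroup.norm_mul_le _ _).trans (Nat.add_le_add ?_ ih)
    cases b
    · simpa using hf a
    · simpa using hf a

/-- A bound on the areas of the words in one set of generators of `G` that represent the identity
gives a bound on the Dehn function of every other finite presentation of `G`. -/
theorem exists_dehnFunction_le {B G : Type*} [DecidableEq B] [Group G] {ψ : FreeGroup B →* G}
    (hψ : Function.Surjective ψ) [Finite B] {T : Set (FreeGroup B)} (hT : T.Finite)
    (hT1 : ∀ r ∈ T, ψ r = 1) {Q : ℕ → ℕ} (hQ : Monotone Q)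
    (hfill : ∀ w : List (B × Bool), ψ (FreeGroup.mk w) = 1 →
      FillsWithin T (Q w.length) (FreeGroup.mk w))
    {A : Type*} [Finite A] {φ : A → G} {R : Set (FreeGroup A)} (hR : IsPresentation φ R) :
    ∃ K ℓ : ℕ, ∀ x, dehnFunction R x ≤ K * Q (ℓ * x) + K * x := by
  obtain ⟨hsurj, hker⟩ := hR
  -- Each set of generators is written in terms of the other.
  choose α hα using fun a => hψ (φ a)
  choose β hβ using fun b => hsurj (ψ (FreeGroup.of b))
  have hβ' : ∀ g, FreeGroup.lift φ (FreeGroup.lift β g) = ψ g := by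
    intro g
    have : (FreeGroup.lift φ).comp (FreeGroup.lift β) = ψ := by
      ext b
      simp [hβ]
    rw [← this]
    rfl
  have hα' : ∀ g, ψ (FreeGroup.lift α g) = FreeGroup.lift φ g := by
    intro g
    have : ψ.comp (FreeGroup.lift α) = FreeGroup.lift φ := by
      ext a
      simp [hα]
    rw [← this]
    rfl
  obtain ⟨K₁, hK₁⟩ := exists_fillsWithin_of_finite (R := R) (hT.image (FreeGroup.lift β)) (by
    rintro _ ⟨r, hr, rfl⟩
    rw [← hker, MonoidHom.mem_ker, hβ', hT1 r hr])
  -- `K₁` bounds the area of the translated relators, `K₂` that of the difference between a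
  -- generator and its double translation; the latter gives the linear term.
  obtain ⟨K₂, hK₂⟩ := exists_fillsWithin_of_finite (R := R)
    (Set.finite_range fun a : A => FreeGroup.of a *
      (FreeGroup.lift β (FreeGroup.lift α (FreeGroup.of a)))⁻¹) (by
    rintro _ ⟨a, rfl⟩
    rw [← hker, MonoidHom.mem_ker, map_mul, map_inv, hβ', hα', mul_inv_cancel])
  obtain ⟨ℓ, hℓ⟩ := (Set.finite_range fun a : A => (α a).norm).bddAbove
  refine ⟨K₁ + K₂, ℓ, fun x => ?_⟩
  obtain ⟨⟨w, hw, hwx, hwA⟩, -⟩ := isGreatest_dehnFunction R x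
  rw [← hwA]
  set g := FreeGroup.lift α (FreeGroup.mk w) with hg
  have h1 : ψ g = 1 := by
    rw [hg, hα']
    exact MonoidHom.mem_ker.1 (hker ▸ hw)
  have h2 := hfill g.toWord (by rwa [FreeGroup.mk_toWord])
  rw [FreeGroup.mk_toWord] at h2
  have h3 := h2.map (FreeGroup.lift β) fun r hr => hK₁ _ ⟨r, hr, rfl⟩
  have h4 := near_endomorphism ((FreeGroup.lift β).comp (FreeGroup.lift α)) (R := R) (K := K₂)
    (fun a => hK₂ _ ⟨a, rfl⟩) w
  have h5 : Near R (K₁ * Q g.toWord.length) (FreeGroup.lift β g) 1 := by simpa [Near] using h3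
  refine ((h4.trans h5).fillsWithin.mono ?_).wordArea_le
  have h6 : g.toWord.length ≤ ℓ * x :=
    (FreeGroup.norm_lift_mk_le α (fun a => hℓ ⟨a, rfl⟩) w).trans (Nat.mul_le_mul_left _ hwx)
  have h7 : K₁ * Q g.toWord.length ≤ K₁ * Q (ℓ * x) := Nat.mul_le_mul_left _ (hQ h6)
  have h8 : K₂ * w.length ≤ K₂ * x := Nat.mul_le_mul_left _ hwx
  rw [add_mul, add_mul]
  omega

theorem growthLE_exp_of_le {f : ℕ → ℕ} {K ℓ D b : ℕ}
    (h : ∀ x, f x ≤ K * (D * (2 ^ b) ^ (ℓ * x)) + K * x) :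
    GrowthLE (fun x => (f x : ℝ)) (fun x => Real.exp x) := by
  -- The sum dominates both coefficients and the exponent rate at once, since `2 ^ b` is at most
  -- `exp b`.
  set C : ℕ := K * D + K + b * ℓ + 1 with hC
  have h2 : (2 : ℝ) ≤ Real.exp 1 := by
    have := Real.add_one_le_exp 1
    linarith
  have key : ∀ x : ℕ, (f x : ℝ) ≤ C * Real.exp (C * x + C) + C * x + C := by
    intro x
    have h1 : (f x : ℝ) ≤ K * (D * (2 ^ b) ^ (ℓ * x)) + K * x := by exact_mod_cast h x
    have h3 : ((2 : ℝ) ^ b) ^ (ℓ * x) ≤ Real.exp (C * x + C) := by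
      calc ((2 : ℝ) ^ b) ^ (ℓ * x) ≤ (Real.exp 1 ^ b) ^ (ℓ * x) := by gcongr
        _ = Real.exp (b * ℓ * x) := by
          rw [← pow_mul, ← Real.exp_nat_mul]
          push_cast
          ring_nf
        _ ≤ Real.exp (C * x + C) := by
          apply Real.exp_le_exp.2
          have e1 : (b * ℓ : ℝ) ≤ C := by
            have : b * ℓ ≤ C := by omega
            exact_mod_cast this
          have e2 : (b * ℓ * x : ℝ) ≤ C * x := by gcongr
          have e3 : (0 : ℝ) ≤ C := Nat.cast_nonneg _
          linarith
    have h4 : (K * D : ℝ) ≤ C := by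
      have : K * D ≤ C := by omega
      exact_mod_cast this
    have h5 : (K : ℝ) ≤ C := by
      have : K ≤ C := by omega
      exact_mod_cast this
    have h6 : (K * D : ℝ) * (2 ^ b) ^ (ℓ * x) ≤ C * Real.exp (C * x + C) := by gcongr
    have h7 : (K * x : ℝ) ≤ C * x := by gcongr
    have h8 : (0 : ℝ) ≤ C := Nat.cast_nonneg _
    linarith
  refine ⟨C, by omega, fun x => ?_⟩
  have := key x
  push_cast
  exact this

end Transfer

/-! ### Exponential bound and conclusion -/

section Main

/-- The map from the free group onto Houghton's group. -/
def toHoughton (m : ℕ) : FreeGroup (HGen m) →* houghtonGroup (m + 3) :=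
  FreeGroup.lift fun s => ⟨genPerm s, genPerm_mem s⟩

theorem coe_toHoughton {m : ℕ} (g : FreeGroup (HGen m)) :
    (toHoughton m g : Equiv.Perm (Fin (m + 3) × ℕ)) = wordPerm m g := by
  have : (houghtonGroup (m + 3)).subtype.comp (toHoughton m) = wordPerm m := by
    ext1 s
    simp [toHoughton, wordPerm]
  rw [← this]
  rfl

theorem toHoughton_eq_one {m : ℕ} {g : FreeGroup (HGen m)} :
    toHoughton m g = 1 ↔ wordPerm m g = 1 := by
  rw [← coe_toHoughton, OneMemClass.coe_eq_one]

theorem toHoughton_surjective (m : ℕ) : Function.Surjective (toHoughton m) := by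
  rintro ⟨f, hf⟩
  rw [← range_wordPerm] at hf
  obtain ⟨g, hg⟩ := hf
  exact ⟨g, Subtype.ext ((coe_toHoughton g).trans hg)⟩

/-- Every linear factor is bounded by a multiple of `2 ^ x`. The rule cost contributes `(2 ^ 3 * 9)
^ x` and the word reduction `(2 ^ 3) ^ x`; their product is at most `(2 ^ 10) ^ x`. The constant is
`90 * 5 * 13 * 5 * 9 + 20 = 263270`. -/
theorem area_bound_le (m x : ℕ) :
    (90 * (x + 1) * ((2 * (x + 1) + 3) * ((6 * (x + 1) + 7) * (5 * 9 ^ (x + 1)))) + 20) * (x * x) +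
      (90 * (x + 1) * ((2 * (x + 1) + 3) * ((6 * (x + 1) + 7) * (5 * 9 ^ (x + 1)))) + 20) *
        (x * x * x) +
      2 * (90 * (x + 1) * ((2 * (x + 1) + 3) * ((6 * (x + 1) + 7) * (5 * 9 ^ (x + 1)))) + 20) *
        (x + x * x) * ((m + 3) * (x + 2)) ≤
      263270 * (2 + 8 * (m + 3)) * (2 ^ 10) ^ x := by
  have hx : x + 1 ≤ 2 ^ x := Nat.lt_two_pow_self
  set t := 2 ^ x with ht
  set n := 9 ^ x with hn
  have hn1 : 1 ≤ n := Nat.one_le_pow _ _ (by norm_num)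
  have ht1 : 1 ≤ t := by omega
  have hV : 90 * (x + 1) * ((2 * (x + 1) + 3) * ((6 * (x + 1) + 7) * (5 * 9 ^ (x + 1)))) + 20 ≤
      263270 * (t ^ 3 * n) := by
    have h1 : 90 * (x + 1) * ((2 * (x + 1) + 3) * ((6 * (x + 1) + 7) * (5 * 9 ^ (x + 1)))) ≤
        90 * t * ((5 * t) * ((13 * t) * (5 * (n * 9)))) := by
      rw [pow_succ]
      gcongr <;> omega
    have h2 : 1 ≤ t ^ 3 * n := Nat.one_le_iff_ne_zero.2 (by positivity)
    calc _ ≤ 90 * t * ((5 * t) * ((13 * t) * (5 * (n * 9)))) + 20 * (t ^ 3 * n) := by omega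
      _ = 263270 * (t ^ 3 * n) := by ring
  set V := 90 * (x + 1) * ((2 * (x + 1) + 3) * ((6 * (x + 1) + 7) * (5 * 9 ^ (x + 1)))) + 20
  have hxt : x ≤ t := by omega
  have hx2 : x * x ≤ t ^ 3 := by
    calc x * x ≤ t * t * 1 := by rw [mul_one]; gcongr
      _ ≤ t * t * t := by gcongr
      _ = t ^ 3 := by ring
  have hx3 : x * x * x ≤ t ^ 3 := by
    calc x * x * x ≤ t * t * t := by gcongr
      _ = t ^ 3 := by ring
  have hx4 : (x + x * x) * (x + 2) ≤ 4 * t ^ 3 := by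
    calc (x + x * x) * (x + 2) = x * (x + 1) * (x + 2) := by ring
      _ ≤ t * t * (2 * t) := by gcongr; omega
      _ = 2 * t ^ 3 := by ring
      _ ≤ 4 * t ^ 3 := Nat.mul_le_mul_right _ (by norm_num)
  have hb : t ^ 3 * n * t ^ 3 ≤ (2 ^ 10) ^ x := by
    calc t ^ 3 * n * t ^ 3 = (2 ^ 3 * 9 * 2 ^ 3) ^ x := by
          rw [ht, hn, mul_pow, mul_pow, ← pow_mul, ← pow_mul, mul_comm x 3]
      _ ≤ (2 ^ 10) ^ x := Nat.pow_le_pow_left (by norm_num) x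
  calc V * (x * x) + V * (x * x * x) + 2 * V * (x + x * x) * ((m + 3) * (x + 2))
      = V * (x * x + x * x * x + 2 * (m + 3) * ((x + x * x) * (x + 2))) := by ring
    _ ≤ 263270 * (t ^ 3 * n) * (t ^ 3 + t ^ 3 + 2 * (m + 3) * (4 * t ^ 3)) := by gcongr
    _ = 263270 * (2 + 8 * (m + 3)) * (t ^ 3 * n * t ^ 3) := by ring
    _ ≤ _ := by gcongr

/-- The area of a trivial word in the standard generators is at most exponential. -/
theorem fillsWithin_of_toHoughton_eq_one {m : ℕ} (w : List (HGen m × Bool))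
    (hw : toHoughton m (FreeGroup.mk w) = 1) :
    FillsWithin (shortRelators m) (263270 * (2 + 8 * (m + 3)) * (2 ^ 10) ^ w.length)
      (FreeGroup.mk w) :=
  ((exists_ruleCost m (w.length + 1)).fillsWithin w (toHoughton_eq_one.1 hw)).mono
    (area_bound_le m w.length)

theorem theorem3 (n : ℕ) (hn : 3 ≤ n) :
    Group.IsFinitelyPresented (houghtonGroup n) ∧
      ∀ (A : Type*) [Finite A] (φ : A → houghtonGroup n) (R : Set (FreeGroup A)),
        R.Finite → IsPresentation φ R →
          GrowthLE (fun x => (dehnFunction R x : ℝ)) (fun x => Real.exp x) := by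
  obtain ⟨m, rfl⟩ : ∃ m, n = m + 3 := ⟨n - 3, by omega⟩
  have hT1 : ∀ r ∈ shortRelators m, toHoughton m r = 1 := fun r hr => toHoughton_eq_one.2 hr.2
  constructor
  · refine Group.IsFinitelyPresented.of_surjective (toHoughton m) (toHoughton_surjective m)
      ⟨shortRelators m, shortRelators_finite, le_antisymm ?_ fun g hg => ?_⟩
    · exact Subgroup.normalClosure_le_normal fun r hr => hT1 r hr
    -- A filling of any size puts the word in the normal closure, so the area bound also proves that
    -- the short relators suffice.
    · have := fillsWithin_of_toHoughton_eq_one g.toWord (by rwa [FreeGroup.mk_toWord])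
      rw [FreeGroup.mk_toWord] at this
      exact this.mem_normalClosure
  · intro A _ φ R _ hR
    obtain ⟨K, ℓ, h⟩ := exists_dehnFunction_le (toHoughton_surjective m) shortRelators_finite hT1
      (Q := fun x => 263270 * (2 + 8 * (m + 3)) * (2 ^ 10) ^ x)
      (fun x y hxy => Nat.mul_le_mul_left _ (Nat.pow_le_pow_right (by norm_num) hxy))
      fillsWithin_of_toHoughton_eq_one hR
    exact growthLE_exp_of_le h

end Main
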